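/- Let $d$ be even, $0\le d\le 10$, $n=10-d$, $N=2^{5-d/2}$, and let $\mathcal H_L,\mathcal H_R$ be complex Hilbert spaces. Let $\delta_1,\dots,\delta_n$ be Hermitian complex $N\times N$ matrices with $\delta_i\delta_j+\delta_j\delta_i=2\delta_{ij}\mathbb 1$. On the Hilbert space $\mathcal H_{LR}=\mathrm{HS}(\mathcal H_R,\mathcal H_L)\otimes\mathbb C^{N}$, where $\mathrm{HS}$ denotes the Hilbert–Schmidt operators with the Hilbert–Schmidt inner product, put $\theta=i^{-n/2}\,\mathbb 1\otimes\delta_1\cdots\delta_n$. For (possibly unbounded) self-adjoint operators $X^i_{L}$ on $\mathcal H_L$ and $X^i_R$ on $\mathcal H_R$, $1\le i\le n$, the Dirac operator is $$\Delta\Psi=\sum_{i=1}^{n}\delta_i\,\bigl(X^i_L\Psi-\Psi X^i_R\bigr),$$ where $\Psi\mapsto X\Psi$ has as domain the Hilbert–Schmidt $\Psi$ with range in $D(X)$ and $X\Psi$ Hilbert–Schmidt, $\Psi\mapsto\Psi X$ has as domain those $\Psi$ for which $\Psi X$ extends from $D(X)$ to a Hilbert–Schmidt operator (the value being this extension), these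 operations act on every spinor component, and sums and products of unbounded operators have their natural domains: $D(A+B)=D(A)\cap D(B)$, $D(BA)=\{x\in D(A): Ax\in D(B)\}$. An operator $B$ is $A$-bounded if $D(A)\subset D(B)$ and there are $a,b>0$ with $\|Bx\|\le a\|Ax\|+b\|x\|$ for all $x\in D(A)$. An operator has discrete spectrum if every point of its spectrum is an isolated point of the spectrum and an eigenvalue of finite multiplicity. For a simple closed curve $\Gamma$ in $\mathbb C$, $P_\Gamma(A)$ is the orthogonal projector onto the closed span of the eigenspaces of $A$ whose eigenvalues are encircled by $\Gamma$. The chirality index of $D$ is $$\Xi(D)=\mathrm{Tr}\bigl(P_\Gamma(D^2)\,\theta\bigr),$$ where $\Gamma$ is any simple closed curve that encircles $0$ and contains no eigenvalue of $D^2$; it is well defined if such curves exist and the trace exists and is the same for all of them. Let $X^i_L,\tilde X^i_L$ on $\mathcal H_L$ and $X^i_R,\tilde X^i_R$ on $\mathcal H_R$ be self-adjoint, with Dirac operators $\Delta$ (of the $X^i_{L/R}$) and $\tilde\Delta$ (of the $\tilde X^i_{L/R}$). Suppose that $\Delta^2$ has discrete spectrum and that $\tilde\Delta^2$ and $\{\tilde\Delta,\Delta\}=\tilde\Delta\Delta+\Delta\tilde\Delta$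 are both $\Delta^2$-bounded. Then $\Xi(\Delta)$ is well defined and an integer, and there is a neighbourhood $U$ of $0$ in $\mathbb R$ such that for all $\lambda\in U$ the operator $(\Delta+\lambda\tilde\Delta)^2$ has discrete spectrum, $\Xi(\Delta+\lambda\tilde\Delta)$ is well defined, and $$\Xi(\Delta+\lambda\tilde\Delta)=\Xi(\Delta).$$ -/

import Mathlib

open scoped InnerProductSpace Topology

noncomputable section

namespace IntersectingBranes

/-! ### Hilbert-Schmidt operators -/

section HilbertSchmidt

set_option linter.unusedSectionVars false

universe u v

variable (K : Type u) (H : Type v)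
  [NormedAddCommGroup K] [InnerProductSpace ℂ K] [CompleteSpace K]
  [NormedAddCommGroup H] [InnerProductSpace ℂ H] [CompleteSpace H]

/-- The vectors of a reference orthonormal basis of `K`. -/
def refIndex : Set K := (exists_hilbertBasis ℂ K).choose

/-- A reference orthonormal basis of `K`; the Hilbert-Schmidt condition and inner product
do not depend on it. -/
def refBasis : HilbertBasis (refIndex K) ℂ K :=
  (exists_hilbertBasis ℂ K).choose_spec.choose

/-- The bounded operators `T : K → H` with `∑ ‖T b‖ ^ 2 < ∞` over an orthonormal basis. -/
def hsSubmodule : Submodule ℂ (K →L[ℂ] H) where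
  carrier := {T | Memℓp (fun i => T (refBasis K i)) 2}
  zero_mem' := by
    change Memℓp (0 : refIndex K → H) 2
    exact zero_memℓp
  add_mem' := fun {S T} hS hT => by
    have h := Memℓp.add hS hT
    exact h
  smul_mem' := fun c T hT => by
    have h := Memℓp.const_smul hT c
    exact h

/-- The space of Hilbert-Schmidt operators from `K` to `H`. -/
def HS : Type (max u v) := ↥(hsSubmodule K H)

namespace HS

instance : AddCommGroup (HS K H) := inferInstanceAs (AddCommGroup ↥(hsSubmodule K H))

instance : Module ℂ (HS K H) := inferInstanceAs (Module ℂ ↥(hsSubmodule K H))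

variable {K H}

/-- The bounded operator underlying a Hilbert-Schmidt operator. -/
def toCLM : HS K H →ₗ[ℂ] (K →L[ℂ] H) := (hsSubmodule K H).subtype

theorem toCLM_injective : Function.Injective (toCLM : HS K H →ₗ[ℂ] (K →L[ℂ] H)) :=
  Subtype.val_injective

/-- The square-summable family `(T b)_b` of a Hilbert-Schmidt operator `T`. -/
def coords : HS K H →ₗ[ℂ] lp (fun _ : refIndex K => H) 2 where
  toFun T := ⟨fun i => toCLM T (refBasis K i), T.2⟩
  map_add' S T := by
    ext i
    exact congrArg (fun A : K →L[ℂ] H => A (refBasis K i)) (map_add toCLM S T)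
  map_smul' c T := by
    ext i
    exact congrArg (fun A : K →L[ℂ] H => A (refBasis K i)) (map_smul toCLM c T)

theorem coords_apply (T : HS K H) (i : refIndex K) :
    coords T i = toCLM T (refBasis K i) := rfl

theorem coords_injective :
    Function.Injective (coords : HS K H →ₗ[ℂ] lp (fun _ : refIndex K => H) 2) := by
  intro S T h
  apply toCLM_injective
  apply ContinuousLinearMap.ext_on
    (s := Set.range (refBasis K))
  · have := (refBasis K).dense_span
    rwa [Submodule.dense_iff_topologicalClosure_eq_top]
  · rintro _ ⟨i, rfl⟩
    rw [← coords_apply, ← coords_apply, h]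

instance : NormedAddCommGroup (HS K H) :=
  NormedAddCommGroup.induced (HS K H) (lp (fun _ : refIndex K => H) 2) coords coords_injective

theorem norm_eq (T : HS K H) : ‖T‖ = ‖coords T‖ := rfl

/-- The Hilbert-Schmidt inner product `∑ ⟪S b, T b⟫`. -/
instance : InnerProductSpace ℂ (HS K H) where
  norm_smul_le c T := by
    rw [norm_eq, norm_eq, map_smul, norm_smul]
  inner S T := ⟪coords S, coords T⟫_ℂ
  norm_sq_eq_re_inner T := by
    rw [norm_eq]
    exact norm_sq_eq_re_inner (𝕜 := ℂ) (coords T)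
  conj_inner_symm S T := inner_conj_symm (coords S) (coords T)
  add_left R S T := by
    rw [map_add, inner_add_left]
  smul_left S T c := by
    rw [map_smul, inner_smul_left]

theorem inner_eq_tsum (S T : HS K H) :
    ⟪S, T⟫_ℂ = ∑' i, ⟪toCLM S (refBasis K i), toCLM T (refBasis K i)⟫_ℂ :=
  lp.inner_eq_tsum (coords S) (coords T)

theorem coords_surjective :
    Function.Surjective (coords : HS K H →ₗ[ℂ] lp (fun _ : refIndex K => H) 2) := by
  intro f
  set b := refBasis K with hb
  have hf : HasSum (fun i => ‖f i‖ ^ 2) (‖f‖ ^ 2) := by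
    have h := lp.hasSum_norm (p := 2) (by norm_num) f
    simpa using h
  have hx : ∀ x : K, HasSum (fun i => ‖b.repr x i‖ ^ 2) (‖x‖ ^ 2) := by
    intro x
    have h := lp.hasSum_norm (p := 2) (by norm_num) (b.repr x)
    simpa using h
  have key : ∀ x : K, Summable (fun i => ‖b.repr x i • f i‖) ∧
      ∑' i, ‖b.repr x i • f i‖ ≤ ‖f‖ * ‖x‖ := by
    intro x
    have h := Real.summable_and_inner_le_Lp_mul_Lq_tsum_of_nonneg (p := 2) (q := 2)
      (f := fun i => ‖b.repr x i‖) (g := fun i => ‖f i‖)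
      Real.HolderConjugate.two_two (fun _ => norm_nonneg _) (fun _ => norm_nonneg _)
      (by simpa using (hx x).summable) (by simpa using hf.summable)
    simp only [norm_smul]
    refine ⟨h.1, h.2.trans (le_of_eq ?_)⟩
    have e1 : (∑' i, ‖b.repr x i‖ ^ (2 : ℝ)) = ‖x‖ ^ 2 := by simpa using (hx x).tsum_eq
    have e2 : (∑' i, ‖f i‖ ^ (2 : ℝ)) = ‖f‖ ^ 2 := by simpa using hf.tsum_eq
    rw [e1, e2, ← Real.sqrt_eq_rpow, ← Real.sqrt_eq_rpow, Real.sqrt_sq (norm_nonneg _),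
      Real.sqrt_sq (norm_nonneg _), mul_comm]
  have hs : ∀ x : K, Summable (fun i => b.repr x i • f i) := fun x => (key x).1.of_norm
  let T₀ : K →ₗ[ℂ] H :=
    { toFun := fun x => ∑' i, b.repr x i • f i
      map_add' := fun x y => by
        rw [← (hs x).tsum_add (hs y)]
        simp [add_smul]
      map_smul' := fun c x => by
        rw [RingHom.id_apply, ← (hs x).tsum_const_smul c]
        simp [smul_smul] }
  let T : K →L[ℂ] H := T₀.mkContinuous ‖f‖ fun x =>
    (norm_tsum_le_tsum_norm (key x).1).trans (key x).2
  have hT : ∀ i, T (b i) = f i := by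
    intro i
    change ∑' j, b.repr (b i) j • f j = f i
    classical
    rw [tsum_eq_single i]
    · simp [b.repr_self]
    · intro j hj
      simp [b.repr_self, hj]
  have hmem : T ∈ hsSubmodule K H := by
    change Memℓp (fun i => T (b i)) 2
    simp only [hT]
    exact f.2
  refine ⟨⟨T, hmem⟩, ?_⟩
  ext i
  exact hT i

instance : CompleteSpace (HS K H) := by
  let e : HS K H ≃ₗᵢ[ℂ] lp (fun _ : refIndex K => H) 2 :=
    LinearIsometryEquiv.ofSurjective ⟨coords, fun T => (norm_eq T).symm⟩ coords_surjective
  exact (completeSpace_congr (e := e.toEquiv) e.isometry.isUniformEmbedding).2 inferInstance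

end HS

end HilbertSchmidt

/-! ### Unbounded operators -/

section Unbounded

universe u

variable {E : Type u} [NormedAddCommGroup E] [InnerProductSpace ℂ E]

/-- The product `B A` on its natural domain `{x ∈ D(A) | A x ∈ D(B)}`. -/
def opMul (B A : E →ₗ.[ℂ] E) : E →ₗ.[ℂ] E where
  domain := (B.domain.comap A.toFun).map A.domain.subtype
  toFun :=
    { toFun := fun x => B ⟨A ⟨x, by
          obtain ⟨y, -, hy⟩ := x.2
          exact hy ▸ y.2⟩, by
          obtain ⟨_, y, hy, rfl⟩ := x
          exact hy⟩
      map_add' := fun x y => by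
        rw [← LinearPMap.map_add]
        congr 1
        apply Subtype.ext
        change A _ = A _ + A _
        rw [← LinearPMap.map_add]
        rfl
      map_smul' := fun c x => by
        rw [RingHom.id_apply, ← LinearPMap.map_smul]
        congr 1
        apply Subtype.ext
        change A _ = c • A _
        rw [← LinearPMap.map_smul]
        rfl }

theorem mem_opMul_domain (B A : E →ₗ.[ℂ] E) (x : E) :
    x ∈ (opMul B A).domain ↔ ∃ h : x ∈ A.domain, A ⟨x, h⟩ ∈ B.domain := by
  constructor
  · rintro ⟨y, hy, rfl⟩
    exact ⟨y.2, hy⟩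
  · rintro ⟨h, hx⟩
    exact ⟨⟨x, h⟩, hx, rfl⟩

/-- The square of an operator. -/
def opSq (A : E →ₗ.[ℂ] E) : E →ₗ.[ℂ] E := opMul A A

/-- The anticommutator `{B, A} = B A + A B`. -/
def antiComm (B A : E →ₗ.[ℂ] E) : E →ₗ.[ℂ] E := opMul B A + opMul A B

/-- `B` is `A`-bounded. -/
def IsRelBounded (B A : E →ₗ.[ℂ] E) : Prop :=
  ∃ h : A.domain ≤ B.domain, ∃ a b : ℝ, 0 < a ∧ 0 < b ∧
    ∀ x : A.domain, ‖B ⟨x, h x.2⟩‖ ≤ a * ‖A x‖ + b * ‖(x : E)‖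

/-- The eigenspace `{x ∈ D(A) | A x = z x}`. -/
def eigenspace (A : E →ₗ.[ℂ] E) (z : ℂ) : Submodule ℂ E :=
  (LinearMap.ker (A.toFun - z • A.domain.subtype)).map A.domain.subtype

/-- `z` is an eigenvalue of `A`. -/
def IsEigenvalue (A : E →ₗ.[ℂ] E) (z : ℂ) : Prop := eigenspace A z ≠ ⊥

/-- `z` lies in the resolvent set of `A`: the operator `A - z` maps `D(A)` bijectively onto `E`,
with bounded inverse `R`. -/
def InResolventSet (A : E →ₗ.[ℂ] E) (z : ℂ) : Prop :=
  ∃ R : E →L[ℂ] E,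
    (∀ y : E, ∃ h : R y ∈ A.domain, A ⟨R y, h⟩ - z • R y = y) ∧
    (∀ x : A.domain, R (A x - z • (x : E)) = x)

/-- `A` has discrete spectrum: every point of the spectrum is an isolated point of the spectrum
and an eigenvalue of finite multiplicity. -/
def HasDiscreteSpectrum (A : E →ₗ.[ℂ] E) : Prop :=
  ∀ z : ℂ, ¬ InResolventSet A z →
    IsEigenvalue A z ∧ FiniteDimensional ℂ (eigenspace A z) ∧
      ∀ᶠ w in 𝓝[≠] z, InResolventSet A w

/-- `t` is the trace of the bounded operator `T`: for every orthonormal basis `b`, the series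
`∑ ⟪b i, T (b i)⟫` converges (unconditionally) to `t`. -/
def HasTrace (T : E →L[ℂ] E) (t : ℂ) : Prop :=
  ∀ (ι : Type u) (b : HilbertBasis ι ℂ E), HasSum (fun i => ⟪b i, T (b i)⟫_ℂ) t

/-- A simple closed curve in the complex plane. -/
structure ClosedCurve where
  /-- the parametrization -/
  toFun : Circle → ℂ
  continuous' : Continuous toFun
  injective' : Function.Injective toFun

/-- The points of the curve. -/
def ClosedCurve.image (Γ : ClosedCurve) : Set ℂ := Set.range Γ.toFun

/-- `Γ` encircles `z`: the point `z` is off the curve and in the bounded component of its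
complement. -/
def ClosedCurve.Encircles (Γ : ClosedCurve) (z : ℂ) : Prop :=
  z ∉ Γ.image ∧ Bornology.IsBounded (connectedComponentIn Γ.imageᶜ z)

variable [CompleteSpace E]

/-- `P_Γ(A)`: the orthogonal projector onto the (closed) span of the eigenspaces of `A` whose
eigenvalues are encircled by `Γ`. -/
def spectralProj (A : E →ₗ.[ℂ] E) (Γ : ClosedCurve) : E →L[ℂ] E :=
  (⨆ z ∈ {z : ℂ | Γ.Encircles z}, eigenspace A z).topologicalClosure.starProjection

/-- `Γ` is a contour that may be used in the index of `D`: it encircles the origin and does not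
meet an eigenvalue of `D²`. -/
def IsAdmissible (D : E →ₗ.[ℂ] E) (Γ : ClosedCurve) : Prop :=
  Γ.Encircles 0 ∧ ∀ z ∈ Γ.image, ¬ IsEigenvalue (opSq D) z

/-- The chirality index `Ξ(D) = Tr (P_Γ(D²) θ)` is well defined and equal to `n`: admissible
contours `Γ` exist, and for each of them the trace exists and equals `n`. -/
def HasChiralityIndex (D : E →ₗ.[ℂ] E) (θ : E →L[ℂ] E) (n : ℤ) : Prop :=
  (∃ Γ : ClosedCurve, IsAdmissible D Γ) ∧
    ∀ Γ : ClosedCurve, IsAdmissible D Γ →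
      HasTrace (spectralProj (opSq D) Γ ∘L θ) (n : ℂ)

end Unbounded

/-! ### The Dirac operator of two intersecting branes -/

section Dirac

universe u v

variable {K : Type u} {H : Type v}
  [NormedAddCommGroup K] [InnerProductSpace ℂ K] [CompleteSpace K]
  [NormedAddCommGroup H] [InnerProductSpace ℂ H] [CompleteSpace H]

/-- Left multiplication `Ψ ↦ X Ψ` by an operator `X` on `H`: the domain consists of the
Hilbert-Schmidt operators `Ψ` with range in `D(X)` for which `X Ψ` is Hilbert-Schmidt. -/
def leftMul (X : H →ₗ.[ℂ] H) : HS K H →ₗ.[ℂ] HS K H :=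
  Submodule.toLinearPMap
    { carrier := {p | ∀ v : K, (HS.toCLM p.1 v, HS.toCLM p.2 v) ∈ X.graph}
      zero_mem' := fun v => by
        simp
      add_mem' := fun {p q} hp hq v => by
        simpa using X.graph.add_mem (hp v) (hq v)
      smul_mem' := fun c p hp v => by
        simpa using X.graph.smul_mem c (hp v) }

/-- Right multiplication `Ψ ↦ Ψ X` by a densely defined operator `X` on `K`: the domain consists
of the Hilbert-Schmidt operators `Ψ` for which `Ψ X`, defined on `D(X)`, extends to a
Hilbert-Schmidt operator on `K`, which is then the value. -/
def rightMul (X : K →ₗ.[ℂ] K) : HS K H →ₗ.[ℂ] HS K H :=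
  Submodule.toLinearPMap
    { carrier := {p | ∀ v : X.domain, HS.toCLM p.2 v = HS.toCLM p.1 (X v)}
      zero_mem' := fun v => by simp
      add_mem' := fun {p q} hp hq v => by
        simp [hp v, hq v]
      smul_mem' := fun c p hp v => by
        simp [hp v] }

variable (K H) in
/-- The space `𝓗_LR = HS(K, H) ⊗ ℂ^N`, as the Hilbert space of `N`-tuples in `HS(K, H)`. -/
abbrev SpinorSpace (N : ℕ) : Type (max u v) := PiLp 2 (fun _ : Fin N => HS K H)

/-- `1 ⊗ M` for a matrix `M` acting on the spinor index. -/
def spinAct {N : ℕ} (M : Matrix (Fin N) (Fin N) ℂ) :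
    SpinorSpace K H N →L[ℂ] SpinorSpace K H N :=
  (PiLp.continuousLinearEquiv 2 ℂ (fun _ : Fin N => HS K H)).symm.toContinuousLinearMap ∘L
    (ContinuousLinearMap.pi fun a => ∑ b, M a b •
      ContinuousLinearMap.proj (R := ℂ) (φ := fun _ : Fin N => HS K H) b) ∘L
    (PiLp.continuousLinearEquiv 2 ℂ (fun _ : Fin N => HS K H)).toContinuousLinearMap

theorem spinAct_apply {N : ℕ} (M : Matrix (Fin N) (Fin N) ℂ) (Ψ : SpinorSpace K H N)
    (a : Fin N) : spinAct M Ψ a = ∑ b, M a b • Ψ b := by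
  simp [spinAct]

/-- `A ⊗ 1`: an operator `A` acting on every spinor component. -/
def spinLift {N : ℕ} (A : HS K H →ₗ.[ℂ] HS K H) :
    SpinorSpace K H N →ₗ.[ℂ] SpinorSpace K H N where
  domain :=
    { carrier := {Ψ | ∀ a, Ψ a ∈ A.domain}
      zero_mem' := fun a => A.domain.zero_mem
      add_mem' := fun {Ψ Φ} hΨ hΦ a => A.domain.add_mem (hΨ a) (hΦ a)
      smul_mem' := fun c Ψ hΨ a => A.domain.smul_mem c (hΨ a) }
  toFun :=
    { toFun := fun Ψ => WithLp.toLp 2 fun a => A ⟨Ψ.1 a, Ψ.2 a⟩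
      map_add' := fun Ψ Φ => by
        ext1 a
        change A _ = A _ + A _
        rw [← LinearPMap.map_add]
        rfl
      map_smul' := fun c Ψ => by
        ext1 a
        change A _ = c • A _
        rw [← LinearPMap.map_smul]
        rfl }

/-- Hermitian generators of the `n`-dimensional Euclidean Clifford algebra:
`δ_i δ_j + δ_j δ_i = 2 δ_{ij}`. -/
structure IsEuclideanClifford {n N : ℕ} (δ : Fin n → Matrix (Fin N) (Fin N) ℂ) : Prop where
  hermitian : ∀ i, (δ i).IsHermitian
  anticomm : ∀ i j, δ i * δ j + δ j * δ i = if i = j then 2 else 0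

/-- The Dirac operator `Δ Ψ = ∑_i δ_i (X_L^i Ψ - Ψ X_R^i)`, every sum being taken on the
intersection of the domains of the summands. -/
def dirac {n N : ℕ} (δ : Fin n → Matrix (Fin N) (Fin N) ℂ)
    (XL : Fin n → H →ₗ.[ℂ] H) (XR : Fin n → K →ₗ.[ℂ] K) :
    SpinorSpace K H N →ₗ.[ℂ] SpinorSpace K H N :=
  ∑ i, (spinAct (δ i)).toLinearMap.compPMap (spinLift (leftMul (XL i) - rightMul (XR i)))

/-- The chirality operator `θ = i^{-n/2} δ_1 ⋯ δ_n` (for even `n`). -/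
def chirality {n N : ℕ} (δ : Fin n → Matrix (Fin N) (Fin N) ℂ) :
    SpinorSpace K H N →L[ℂ] SpinorSpace K H N :=
  spinAct ((Complex.I⁻¹) ^ (n / 2) • (List.ofFn δ).prod)

end Dirac

end IntersectingBranes

end

open scoped InnerProductSpace Topology

noncomputable section

namespace IntersectingBranes

section AbstractOperators

variable {E : Type*} [NormedAddCommGroup E] [InnerProductSpace ℂ E]

/-! ### Operators through their graphs -/

/-! The index only counts zero modes. `Δ` is symmetric and anticommutes with `θ`, so on a
finite-dimensional `Δ`-invariant space `V` containing `ker Δ²` it exchanges the two chiralities, and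
its nonzero modes cancel in the trace of `θ` (`signedDim_eq_signedDim_ker`). A contour encircles
only a bounded set of eigenvalues, which span such a `V`; hence every admissible contour gives the
same integer, the signed dimension of `ker Δ²` (`IsSqResolvent.hasChiralityIndex`).

For stability everything is expressed through the bounded operator `R = (Δ² + 1)⁻¹`. It exists
because a symmetric operator has no eigenvector of `Δ²` at `-1`, and discreteness leaves no other
kind of spectrum; no self-adjointness of `Δ` itself is needed. Discreteness of the spectrum of `Δ²`
is equivalent to compactness of `R`. Relative boundedness makes `B = {Δ', Δ} R` and `C = Δ'² R`
bounded, and `((Δ + tΔ')² + 1) R = 1 + tB + t²C` is invertible for small `t`. So `R_t = R (1 + tB +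
t²C)⁻¹` is the perturbed resolvent (`IsSqResolvent.perturb`): it is again compact and tends to `R`
in norm.

Now fix `c` in `(0, 1)` off the spectrum of `R`. The spectral subspaces of `R` and `R_t` above `c`
are finite-dimensional, and when `‖R_t - R‖` is less than the spectral gap at `c`, each spectral
projection is injective on the other's range. The projections commute with `θ`, so the signed
dimensions agree (`signedDim_cutSpace_eq_of_norm_sub_lt`). Both subspaces contain the zero modes,
where the resolvent equals `1 > c`, so both signed dimensions are indices. The index is thus
compared without following individual eigenvalues, which may leave zero in pairs. -/

theorem mem_graph_opMul {B A : E →ₗ.[ℂ] E} {x z : E} :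
    (x, z) ∈ (opMul B A).graph ↔ ∃ y, (x, y) ∈ A.graph ∧ (y, z) ∈ B.graph := by
  constructor
  · intro h
    obtain ⟨⟨u, hu⟩, rfl, rfl⟩ := (LinearPMap.mem_graph_iff _).1 h
    obtain ⟨h1, h2⟩ := (mem_opMul_domain B A u).1 hu
    exact ⟨A ⟨u, h1⟩, A.mem_graph ⟨u, h1⟩, B.mem_graph ⟨_, h2⟩⟩
  · rintro ⟨y, hxy, hyz⟩
    obtain ⟨⟨u, hu⟩, rfl, rfl⟩ := (LinearPMap.mem_graph_iff _).1 hxy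
    obtain ⟨⟨v, hv⟩, hv', rfl⟩ := (LinearPMap.mem_graph_iff _).1 hyz
    have e : v = A ⟨u, hu⟩ := hv'
    refine (LinearPMap.mem_graph_iff _).2
      ⟨⟨u, (mem_opMul_domain B A u).2 ⟨hu, e ▸ hv⟩⟩, rfl, ?_⟩
    change B _ = B _
    congr 1
    exact Subtype.ext e.symm

theorem mem_graph_add {B A : E →ₗ.[ℂ] E} {x z : E} :
    (x, z) ∈ (A + B).graph ↔ ∃ a b, (x, a) ∈ A.graph ∧ (x, b) ∈ B.graph ∧ z = a + b := by
  constructor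
  · intro h
    obtain ⟨⟨u, hu⟩, rfl, rfl⟩ := (LinearPMap.mem_graph_iff _).1 h
    exact ⟨A ⟨u, hu.1⟩, B ⟨u, hu.2⟩, A.mem_graph ⟨u, hu.1⟩, B.mem_graph ⟨u, hu.2⟩, rfl⟩
  · rintro ⟨a, b, ha, hb, rfl⟩
    obtain ⟨⟨u, hu⟩, rfl, rfl⟩ := (LinearPMap.mem_graph_iff _).1 ha
    obtain ⟨⟨v, hv⟩, hv', rfl⟩ := (LinearPMap.mem_graph_iff _).1 hb
    obtain rfl : v = u := hv'
    exact (LinearPMap.mem_graph_iff _).2 ⟨⟨v, hu, hv⟩, rfl, rfl⟩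

theorem mem_graph_smul {A : E →ₗ.[ℂ] E} {c : ℂ} {x z : E} :
    (x, z) ∈ (c • A).graph ↔ ∃ a, (x, a) ∈ A.graph ∧ z = c • a := by
  constructor
  · intro h
    obtain ⟨⟨u, hu⟩, rfl, rfl⟩ := (LinearPMap.mem_graph_iff _).1 h
    exact ⟨A ⟨u, hu⟩, A.mem_graph ⟨u, hu⟩, rfl⟩
  · rintro ⟨a, ha, rfl⟩
    obtain ⟨⟨u, hu⟩, rfl, rfl⟩ := (LinearPMap.mem_graph_iff _).1 ha
    exact (LinearPMap.mem_graph_iff _).2 ⟨⟨u, hu⟩, rfl, rfl⟩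

theorem mem_graph_opSq {A : E →ₗ.[ℂ] E} {x z : E} :
    (x, z) ∈ (opSq A).graph ↔ ∃ y, (x, y) ∈ A.graph ∧ (y, z) ∈ A.graph :=
  mem_graph_opMul

theorem mem_graph_antiComm {B A : E →ₗ.[ℂ] E} {x z : E} :
    (x, z) ∈ (antiComm B A).graph ↔ ∃ y y' w w', (x, y) ∈ A.graph ∧ (y, w) ∈ B.graph ∧
      (x, y') ∈ B.graph ∧ (y', w') ∈ A.graph ∧ z = w + w' := by
  simp only [antiComm, mem_graph_add, mem_graph_opMul]
  constructor
  · rintro ⟨a, b, ⟨y, h1, h2⟩, ⟨y', h3, h4⟩, rfl⟩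
    exact ⟨y, y', a, b, h1, h2, h3, h4, rfl⟩
  · rintro ⟨y, y', a, b, h1, h2, h3, h4, rfl⟩
    exact ⟨a, b, ⟨y, h1, h2⟩, ⟨y', h3, h4⟩, rfl⟩

theorem mem_eigenspace_iff {A : E →ₗ.[ℂ] E} {z : ℂ} {x : E} :
    x ∈ eigenspace A z ↔ (x, z • x) ∈ A.graph := by
  constructor
  · rintro ⟨u, hu, rfl⟩
    refine (LinearPMap.mem_graph_iff _).2 ⟨u, rfl, ?_⟩
    have : A u - z • (u : E) = 0 := hu
    exact sub_eq_zero.1 this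
  · intro h
    obtain ⟨u, rfl, hu⟩ := (LinearPMap.mem_graph_iff _).1 h
    refine ⟨u, ?_, rfl⟩
    change A u - z • (u : E) = 0
    exact sub_eq_zero.2 hu

theorem inResolventSet_iff {A : E →ₗ.[ℂ] E} {z : ℂ} :
    InResolventSet A z ↔ ∃ R : E →L[ℂ] E, (∀ y, (R y, y + z • R y) ∈ A.graph) ∧
      ∀ x y, (x, y) ∈ A.graph → R (y - z • x) = x := by
  refine exists_congr fun R => and_congr (forall_congr' fun y => ?_) ?_
  · constructor
    · rintro ⟨h, hy⟩
      exact (LinearPMap.mem_graph_iff _).2 ⟨⟨_, h⟩, rfl, sub_eq_iff_eq_add.1 hy⟩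
    · intro h
      obtain ⟨⟨u, hu⟩, rfl : u = R y, h2⟩ := (LinearPMap.mem_graph_iff _).1 h
      exact ⟨hu, sub_eq_iff_eq_add.2 h2⟩
  · constructor
    · intro h x y hxy
      obtain ⟨u, rfl, rfl⟩ := (LinearPMap.mem_graph_iff _).1 hxy
      exact h u
    · exact fun h x => h _ _ (A.mem_graph x)

theorem IsRelBounded.exists_bound {B A : E →ₗ.[ℂ] E} (h : IsRelBounded B A) :
    ∃ a b : ℝ, 0 < a ∧ 0 < b ∧ ∀ x y, (x, y) ∈ A.graph →
      ∃ w, (x, w) ∈ B.graph ∧ ‖w‖ ≤ a * ‖y‖ + b * ‖x‖ := by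
  obtain ⟨h, a, b, ha, hb, hab⟩ := h
  refine ⟨a, b, ha, hb, fun x y hxy => ?_⟩
  obtain ⟨u, rfl, rfl⟩ := (LinearPMap.mem_graph_iff _).1 hxy
  exact ⟨_, B.mem_graph ⟨u, h u.2⟩, hab u⟩

theorem graph_unique {A : E →ₗ.[ℂ] E} {x y z : E} (h : (x, y) ∈ A.graph) (h' : (x, z) ∈ A.graph) :
    y = z :=
  A.mem_graph_snd_inj h h' rfl

/-- `D` is symmetric: `⟪D x, y⟫ = ⟪x, D y⟫` on its domain. -/
def SymmetricOp (D : E →ₗ.[ℂ] E) : Prop :=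
  ∀ x x' y y', (x, x') ∈ D.graph → (y, y') ∈ D.graph → ⟪x', y⟫_ℂ = ⟪x, y'⟫_ℂ

/-- The bounded operator `θ` preserves the domain of `D` and anticommutes with `D`. -/
def AnticommutesWith (θ : E →L[ℂ] E) (D : E →ₗ.[ℂ] E) : Prop :=
  ∀ x y, (x, y) ∈ D.graph → (θ x, -θ y) ∈ D.graph

theorem SymmetricOp.add {A B : E →ₗ.[ℂ] E} (hA : SymmetricOp A) (hB : SymmetricOp B) :
    SymmetricOp (A + B) := by
  intro x x' y y' hx hy
  obtain ⟨a, b, h1, h2, rfl⟩ := mem_graph_add.1 hx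
  obtain ⟨c, d, h3, h4, rfl⟩ := mem_graph_add.1 hy
  rw [inner_add_left, inner_add_right, hA _ _ _ _ h1 h3, hB _ _ _ _ h2 h4]

theorem SymmetricOp.real_smul {A : E →ₗ.[ℂ] E} (hA : SymmetricOp A) (t : ℝ) :
    SymmetricOp ((t : ℂ) • A) := by
  intro x x' y y' hx hy
  obtain ⟨a, h1, rfl⟩ := mem_graph_smul.1 hx
  obtain ⟨c, h3, rfl⟩ := mem_graph_smul.1 hy
  rw [inner_smul_left, inner_smul_right, hA _ _ _ _ h1 h3, Complex.conj_ofReal]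

theorem AnticommutesWith.add {θ : E →L[ℂ] E} {A B : E →ₗ.[ℂ] E} (hA : AnticommutesWith θ A)
    (hB : AnticommutesWith θ B) : AnticommutesWith θ (A + B) := by
  intro x y hx
  obtain ⟨a, b, h1, h2, rfl⟩ := mem_graph_add.1 hx
  exact mem_graph_add.2 ⟨_, _, hA _ _ h1, hB _ _ h2, by rw [map_add, neg_add]⟩

theorem AnticommutesWith.smul {θ : E →L[ℂ] E} {A : E →ₗ.[ℂ] E} (hA : AnticommutesWith θ A)
    (c : ℂ) : AnticommutesWith θ (c • A) := by
  intro x y hx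
  obtain ⟨a, h1, rfl⟩ := mem_graph_smul.1 hx
  exact mem_graph_smul.2 ⟨_, hA _ _ h1, by rw [map_smul, smul_neg]⟩

theorem AnticommutesWith.opSq {θ : E →L[ℂ] E} {D : E →ₗ.[ℂ] E} (h : AnticommutesWith θ D)
    {x y : E} (hxy : (x, y) ∈ (opSq D).graph) : (θ x, θ y) ∈ (opSq D).graph := by
  obtain ⟨d, h1, h2⟩ := mem_graph_opSq.1 hxy
  refine mem_graph_opSq.2 ⟨_, h _ _ h1, ?_⟩
  have := D.graph.neg_mem (h _ _ h2)
  simpa using this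

/-! ### The resolvent of the square of a symmetric operator -/

theorem SymmetricOp.inner_opSq {D : E →ₗ.[ℂ] E} (hD : SymmetricOp D) {x y : E}
    (h : (x, y) ∈ (opSq D).graph) :
    ∃ d, (x, d) ∈ D.graph ∧ (d, y) ∈ D.graph ∧ ⟪x, y⟫_ℂ = ((‖d‖ ^ 2 : ℝ) : ℂ) := by
  obtain ⟨d, h1, h2⟩ := mem_graph_opSq.1 h
  refine ⟨d, h1, h2, ?_⟩
  rw [← hD _ _ _ _ h1 h2, inner_self_eq_norm_sq_to_K]
  simp

theorem SymmetricOp.opSq {D : E →ₗ.[ℂ] E} (hD : SymmetricOp D) : SymmetricOp (opSq D) := by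
  intro x x' y y' hx hy
  obtain ⟨a, h1, h2⟩ := mem_graph_opSq.1 hx
  obtain ⟨b, h3, h4⟩ := mem_graph_opSq.1 hy
  rw [hD _ _ _ _ h2 h3, hD _ _ _ _ h1 h4]

/-- Pairing with `x` gives `‖D x‖² = -‖x‖²`. This positivity is the source of every uniqueness
statement about `(D² + 1)⁻¹`. -/
theorem SymmetricOp.eq_zero_of_opSq_eq_neg {D : E →ₗ.[ℂ] E} (hD : SymmetricOp D) {x : E}
    (h : (x, -x) ∈ (IntersectingBranes.opSq D).graph) : x = 0 := by
  obtain ⟨d, -, -, hd⟩ := hD.inner_opSq h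
  rw [inner_neg_right, inner_self_eq_norm_sq_to_K] at hd
  have h2 : -‖x‖ ^ 2 = ‖d‖ ^ 2 := by
    apply Complex.ofReal_injective
    rw [← hd]
    simp
  have : ‖x‖ ^ 2 = 0 := le_antisymm (by nlinarith [sq_nonneg ‖d‖]) (sq_nonneg _)
  simpa using this

/-- `R = (D² + 1)⁻¹`. -/
def IsSqResolvent (D : E →ₗ.[ℂ] E) (R : E →L[ℂ] E) : Prop :=
  ∀ y, (R y, y - R y) ∈ (opSq D).graph

namespace IsSqResolvent

variable {D : E →ₗ.[ℂ] E} {R : E →L[ℂ] E}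

/-- `IsSqResolvent` asks only for a right inverse of `D² + 1`. It is also a left inverse, since two
solutions of the same equation differ by an eigenvector of `D²` at `-1`. -/
theorem apply_add (hR : IsSqResolvent D R) (hD : SymmetricOp D) {x y : E}
    (h : (x, y) ∈ (opSq D).graph) : R (y + x) = x := by
  have h1 := (opSq D).graph.sub_mem (hR (y + x)) h
  rw [Prod.mk_sub_mk] at h1
  refine sub_eq_zero.1 (hD.eq_zero_of_opSq_eq_neg ?_)
  convert h1 using 2
  abel

theorem mem_graph_iff (hR : IsSqResolvent D R) (hD : SymmetricOp D) {x y : E} :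
    (x, y) ∈ (opSq D).graph ↔ R (y + x) = x := by
  refine ⟨hR.apply_add hD, fun h => ?_⟩
  have := hR (y + x)
  rwa [h, add_sub_cancel_right] at this

theorem mem_eigenspace_iff (hR : IsSqResolvent D R) (hD : SymmetricOp D) {z : ℂ} {x : E} :
    x ∈ eigenspace (opSq D) z ↔ (z + 1) • R x = x := by
  rw [IntersectingBranes.mem_eigenspace_iff, hR.mem_graph_iff hD]
  rw [← map_smul, add_smul, one_smul]

theorem inner_left (hR : IsSqResolvent D R) (hD : SymmetricOp D) (x y : E) :
    ⟪R x, y⟫_ℂ = ⟪x, R y⟫_ℂ := by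
  have := hD.opSq _ _ _ _ (hR x) (hR y)
  rw [inner_sub_left, inner_sub_right] at this
  linear_combination -this

theorem inner_self (hR : IsSqResolvent D R) (hD : SymmetricOp D) (x : E) :
    ∃ r : ℝ, 0 ≤ r ∧ ⟪R x, x⟫_ℂ = r := by
  obtain ⟨d, -, -, hd⟩ := hD.inner_opSq (hR x)
  refine ⟨‖d‖ ^ 2 + ‖R x‖ ^ 2, by positivity, ?_⟩
  rw [inner_sub_right, inner_self_eq_norm_sq_to_K] at hd
  push_cast at hd ⊢
  exact sub_eq_iff_eq_add.1 hd

theorem nonneg (hR : IsSqResolvent D R) (hD : SymmetricOp D) : 0 ≤ R := by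
  rw [ContinuousLinearMap.nonneg_iff_isPositive]
  refine ContinuousLinearMap.isPositive_def.2 ⟨fun x y => hR.inner_left hD x y, fun x => ?_⟩
  obtain ⟨r, hr, h⟩ := hR.inner_self hD x
  rw [ContinuousLinearMap.reApplyInnerSelf, h]
  simpa using hr

theorem isSelfAdjoint [CompleteSpace E] (hR : IsSqResolvent D R) (hD : SymmetricOp D) : IsSelfAdjoint R :=
  .of_nonneg (hR.nonneg hD)

/-- The two signs cancel in `D²`, so `θ R x` solves `(D² + 1) u = θ x`, and the solution is unique.
-/
theorem commute_of_graph (hR : IsSqResolvent D R) (hD : SymmetricOp D) {θ : E →L[ℂ] E}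
    (h : AnticommutesWith θ D) : Commute θ R := by
  ext x
  have := hR.apply_add hD (h.opSq (hR x))
  rw [← map_add, sub_add_cancel] at this
  exact this.symm

/-- With `S = (D² - z)⁻¹`, the resolvent identity `S - R = (z + 1) R S = (z + 1) S R` exhibits `1 +
(z + 1) S` as the inverse. -/
theorem isUnit_of_inResolventSet (hR : IsSqResolvent D R) (hD : SymmetricOp D) {z : ℂ}
    (h : InResolventSet (opSq D) z) : IsUnit (1 - (z + 1) • R) := by
  obtain ⟨S, hS, hS'⟩ := inResolventSet_iff.1 h
  have h1 : ∀ y, S y - R y = (z + 1) • R (S y) := fun y => by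
    have := hR.apply_add hD (hS y)
    rw [add_assoc, map_add, ← one_smul ℂ (S y), ← mul_smul, ← add_smul, mul_one, map_smul] at this
    rw [one_smul] at this
    nth_rw 1 [← this]
    simp
  have h2 : ∀ y, S y - R y = (z + 1) • S (R y) := fun y => by
    have := hS' _ _ (hR y)
    rw [sub_sub, map_sub, ← one_smul ℂ (R y), ← mul_smul, ← add_smul, mul_one, map_smul] at this
    rw [one_smul] at this
    rw [add_comm z 1]
    exact sub_eq_iff_eq_add.2 (by rw [add_comm]; exact sub_eq_iff_eq_add.1 this)
  refine ⟨⟨1 - (z + 1) • R, 1 + (z + 1) • S, ?_, ?_⟩, rfl⟩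
  · ext y
    have := h1 y
    simp only [mul_apply_eq_comp, sub_apply, add_apply,
      smul_apply, one_apply_eq_self, map_add, map_smul]
    rw [← this]
    module
  · ext y
    have := h2 y
    simp only [mul_apply_eq_comp, sub_apply, add_apply,
      smul_apply, one_apply_eq_self, map_sub, map_smul]
    rw [← this]
    module

/-- From `D² - z = (1 - (z + 1) R) (D² + 1)` the candidate inverse is `R (1 - (z + 1) R)⁻¹`; the
factors commute, which gives both sides. -/
theorem inResolventSet_of_isUnit (hR : IsSqResolvent D R) (hD : SymmetricOp D) {z : ℂ}
    (h : IsUnit (1 - (z + 1) • R)) : InResolventSet (opSq D) z := by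
  obtain ⟨u, hu⟩ := h
  set S : E →L[ℂ] E := ↑u⁻¹ with hS
  have h1 : (1 - (z + 1) • R) * S = 1 := by rw [← hu, hS, Units.mul_inv]
  have h2 : S * (1 - (z + 1) • R) = 1 := by rw [← hu, hS, Units.inv_mul]
  have h3 : R * S = S * R := by
    have : (1 - (z + 1) • R) * R = R * (1 - (z + 1) • R) := by
      rw [sub_mul, mul_sub, one_mul, mul_one, smul_mul_assoc, mul_smul_comm]
    calc R * S = (S * (1 - (z + 1) • R)) * R * S := by rw [h2, one_mul]
      _ = S * R * ((1 - (z + 1) • R) * S) := by rw [mul_assoc S, this]; simp only [mul_assoc]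
      _ = S * R := by rw [h1, mul_one]
  refine inResolventSet_iff.2 ⟨R * S, fun y => ?_, fun x y hxy => ?_⟩
  · have e := congrArg (fun T : E →L[ℂ] E => T y) h1
    simp only [mul_apply_eq_comp, sub_apply,
      smul_apply, one_apply_eq_self] at e
    refine (hR.mem_graph_iff hD).2 ?_
    simp only [mul_apply_eq_comp]
    congr 1
    nth_rw 1 [← e]
    module
  · rw [h3]
    have e := congrArg (fun T : E →L[ℂ] E => T x) h2
    simp only [mul_apply_eq_comp, sub_apply,
      smul_apply, one_apply_eq_self] at e
    rw [mul_apply_eq_comp]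
    nth_rw 2 [← e]
    congr 1
    have := hR.apply_add hD hxy
    nth_rw 2 [← this]
    simp only [map_sub, map_add, map_smul]
    module

theorem inResolventSet_iff_isUnit (hR : IsSqResolvent D R) (hD : SymmetricOp D) {z : ℂ} :
    InResolventSet (opSq D) z ↔ IsUnit (1 - (z + 1) • R) :=
  ⟨hR.isUnit_of_inResolventSet hD, hR.inResolventSet_of_isUnit hD⟩

end IsSqResolvent

theorem HasDiscreteSpectrum.exists_isSqResolvent {D : E →ₗ.[ℂ] E} (hD : SymmetricOp D)
    (h : HasDiscreteSpectrum (opSq D)) : ∃ R, IsSqResolvent D R := by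
  have h1 : InResolventSet (opSq D) (-1) := by
    by_contra hn
    refine (h _ hn).1 ((Submodule.eq_bot_iff _).2 fun x hx => ?_)
    exact hD.eq_zero_of_opSq_eq_neg (by simpa using mem_eigenspace_iff.1 hx)
  obtain ⟨R, hR, -⟩ := inResolventSet_iff.1 h1
  exact ⟨R, fun y => by simpa [sub_eq_add_neg] using hR y⟩

end AbstractOperators

/-! ### Discrete spectrum and compactness of the resolvent -/

section CompactOperators

variable {E : Type*} [NormedAddCommGroup E] [InnerProductSpace ℂ E]

theorem isUnit_one_sub_smul_iff (T : E →L[ℂ] E) {c : ℂ} (hc : c ≠ 0) :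
    IsUnit (1 - c • T) ↔ c⁻¹ ∉ spectrum ℂ T := by
  rw [spectrum.mem_iff, not_not]
  have h : 1 - c • T = (Units.mk0 c hc) • (algebraMap ℂ (E →L[ℂ] E) c⁻¹ - T) := by
    rw [Units.smul_def, smul_sub, Algebra.algebraMap_eq_smul_one, smul_smul]
    simp [hc]
  rw [h, isUnit_smul_iff]

/-- A bounded operator with values in a finite-dimensional subspace is compact. -/
theorem isCompactOperator_of_mem_finiteDimensional (T : E →L[ℂ] E) (V : Submodule ℂ E)
    [FiniteDimensional ℂ V] (h : ∀ x, T x ∈ V) : IsCompactOperator T :=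
  have := FiniteDimensional.proper ℂ V
  (isCompactOperator_of_locallyCompactSpace_dom (T.codRestrict V h)).clm_comp V.subtypeL

namespace IsSqResolvent

variable {D : E →ₗ.[ℂ] E} {R : E →L[ℂ] E}

theorem eigenspace_eq (hR : IsSqResolvent D R) (hD : SymmetricOp D) {z : ℂ} (hz : z + 1 ≠ 0) :
    eigenspace (opSq D) z = Module.End.eigenspace (R : Module.End ℂ E) (z + 1)⁻¹ := by
  ext x
  rw [hR.mem_eigenspace_iff hD, Module.End.mem_eigenspace_iff]
  exact (eq_inv_smul_iff₀ hz).symm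

theorem inResolventSet_iff_notMem_spectrum (hR : IsSqResolvent D R) (hD : SymmetricOp D) {z : ℂ}
    (hz : z + 1 ≠ 0) : InResolventSet (opSq D) z ↔ (z + 1)⁻¹ ∉ spectrum ℂ R := by
  rw [hR.inResolventSet_iff_isUnit hD, isUnit_one_sub_smul_iff R hz]

theorem add_one_ne_zero (hR : IsSqResolvent D R) (hD : SymmetricOp D) {z : ℂ}
    (h : ¬ InResolventSet (opSq D) z) : z + 1 ≠ 0 := by
  intro h0
  rw [hR.inResolventSet_iff_isUnit hD, h0] at h
  simp at h

end IsSqResolvent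

variable [CompleteSpace E]

/-- A self-adjoint bounded operator is compact when its nonzero spectrum consists of isolated
eigenvalues of finite multiplicity. -/
theorem isCompactOperator_of_isolated {T : E →L[ℂ] E} (hT : IsSelfAdjoint T)
    (h : ∀ r ∈ spectrum ℝ T, r ≠ 0 →
      FiniteDimensional ℂ (Module.End.eigenspace (T : Module.End ℂ E) (r : ℂ)) ∧
        ∀ᶠ w in 𝓝[≠] r, w ∉ spectrum ℝ T) : IsCompactOperator T := by
  rw [← Set.mem_ofPred_eq (p := fun S : E →L[ℂ] E => IsCompactOperator S)]
  have hcl := isClosed_setOfPred_isCompactOperator (σ₁₂ := RingHom.id ℂ) (M₁ := E) (M₂ := E)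
  refine hcl.closure_subset (Metric.mem_closure_iff.2 fun ε hε => ?_)
  -- An infinite subset of this compact set would accumulate at a nonzero point of the spectrum,
  -- against isolation. So finitely many spectral points survive the cutoff `ε / 2`.
  set S : Set ℝ := spectrum ℝ T ∩ {x | ε / 2 ≤ |x|} with hS
  have hSc : IsCompact S :=
    (spectrum.isCompact T).inter_right (isClosed_le continuous_const continuous_abs)
  have hS0 : ∀ r ∈ S, r ≠ 0 := by
    rintro r ⟨-, hr⟩ rfl
    simp only [Set.mem_ofPred_eq, abs_zero] at hr
    linarith
  have hfin : S.Finite := by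
    by_contra hinf
    obtain ⟨x, hx, hacc⟩ := Set.Infinite.exists_accPt_of_subset_isCompact hinf hSc subset_rfl
    have h1 := (h x hx.1 (hS0 x hx)).2
    rw [accPt_iff_frequently_nhdsNE] at hacc
    obtain ⟨y, hy, hy'⟩ := (hacc.and_eventually h1).exists
    exact hy' hy.1
  -- Continuous on the spectrum because `r` is isolated there. `T` acts as `r` on the range of `cfc
  -- (g r) T`, which therefore has finite rank; the sum over `S` approximates `T` within `ε / 2`.
  set g : ℝ → ℝ → ℝ := fun r x => if x = r then r else 0 with hg
  have hgc : ∀ r ∈ S, ContinuousOn (g r) (spectrum ℝ T) := by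
    intro r hr x hx
    refine (tendsto_const_nhds (x := g r x)).congr' ?_
    by_cases hxr : x = r
    · subst hxr
      have h1 := (h x hr.1 (hS0 x hr)).2
      rw [eventually_nhdsWithin_iff] at h1
      refine eventually_nhdsWithin_iff.2 (h1.mono fun y hy hy' => ?_)
      by_cases hyx : y = x
      · rw [hyx]
      · exact absurd hy' (hy hyx)
    · have h1 : ∀ᶠ y in 𝓝 x, y ≠ r := isOpen_ne.mem_nhds hxr
      refine eventually_nhdsWithin_iff.2 (h1.mono fun y hy _ => ?_)
      simp [hg, hxr, hy]
  set F : E →L[ℂ] E := ∑ r ∈ hfin.toFinset, cfc (g r) T with hF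
  have hFc : IsCompactOperator F := by
    have hsum : F ∈ compactOperator (RingHom.id ℂ) E E := by
      refine Submodule.sum_mem _ fun r hr => ?_
      rw [Set.Finite.mem_toFinset] at hr
      have := (h r hr.1 (hS0 r hr)).1
      refine isCompactOperator_of_mem_finiteDimensional _
        (Module.End.eigenspace (T : Module.End ℂ E) (r : ℂ)) fun x => ?_
      have key : T * cfc (g r) T = r • cfc (g r) T := by
        nth_rw 1 [← cfc_id' ℝ T]
        rw [← cfc_mul _ _ T (by fun_prop) (hgc r hr), ← cfc_smul r (g r) T (hgc r hr)]
        refine cfc_congr fun x _ => ?_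
        by_cases hxr : x = r <;> simp [hg, hxr]
      rw [Module.End.mem_eigenspace_iff]
      have := congrArg (fun A : E →L[ℂ] E => A x) key
      simpa using this
    exact hsum
  refine ⟨F, hFc, ?_⟩
  have hFe : F = cfc (fun x => ∑ r ∈ hfin.toFinset, g r x) T := by
    rw [hF, ← cfc_sum _ _ _ (fun r hr => hgc r (by simpa using hr))]
    congr 1
    ext x
    simp
  have hsc : ContinuousOn (fun x => ∑ r ∈ hfin.toFinset, g r x) (spectrum ℝ T) :=
    continuousOn_finsetSum _ fun r hr => hgc r (by simpa using hr)
  rw [dist_eq_norm]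
  refine lt_of_le_of_lt ?_ (half_lt_self hε)
  rw [hFe]
  nth_rw 1 [← cfc_id' ℝ T]
  rw [← cfc_sub _ _ T (by fun_prop) hsc]
  refine norm_cfc_le (by positivity) fun x hx => ?_
  by_cases hxS : x ∈ S
  · have : ∑ r ∈ hfin.toFinset, g r x = x := by
      rw [Finset.sum_eq_single x]
      · simp [hg]
      · intro r _ hr
        simp [hg, hr.symm]
      · intro hx'
        exact absurd (by simpa using hxS) hx'
    rw [this]
    simp only [sub_self, norm_zero]
    positivity
  · have : ∑ r ∈ hfin.toFinset, g r x = 0 := by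
      refine Finset.sum_eq_zero fun r hr => ?_
      have : x ≠ r := by
        rintro rfl
        exact hxS (by simpa using hr)
      simp [hg, this]
    rw [this, sub_zero, Real.norm_eq_abs]
    by_contra hlt
    exact hxS ⟨hx, (not_le.1 hlt).le⟩

/-- Nonzero points of the spectrum of a compact symmetric operator are isolated. -/
theorem eventually_notMem_spectrum {T : E →L[ℂ] E} (hc : IsCompactOperator T)
    (hT : IsSelfAdjoint T) {μ : ℂ} (hμ : μ ≠ 0) : ∀ᶠ w in 𝓝[≠] μ, w ∉ spectrum ℂ T := by
  have hsymm : (T : E →ₗ[ℂ] E).IsSymmetric := hT.isSymmetric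
  rcases hc.hasEigenvalue_or_mem_resolventSet hμ with hev | hres
  swap
  · exact Filter.Eventually.filter_mono nhdsWithin_le_nhds
      (((spectrum.isOpen_resolventSet T).eventually_mem hres).mono fun w hw => not_not.2 hw)
  set V := Module.End.eigenspace (T : Module.End ℂ E) μ with hV
  have hreal := hsymm.conj_eigenvalue_eq_self hev
  have hfd : FiniteDimensional ℂ V := ContinuousLinearMap.finite_dimensional_eigenspace hc μ hμ
  -- Adding `Q` moves the eigenvalue `μ` to `μ + 1`, so `μ` falls in the open resolvent set of `T +
  -- Q`. Eigenvectors of `T` for `w ≠ μ` are killed by `Q`, so they remain eigenvectors of `T + Q`;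
  -- hence none exist for `w` near `μ`.
  set Q := V.starProjection with hQ
  have hQc : IsCompactOperator Q :=
    isCompactOperator_of_mem_finiteDimensional _ V fun x => V.starProjection_apply_mem x
  have hTQ : IsCompactOperator (T + Q) := hc.add hQc
  have horth : ∀ (w : ℂ) (x : E), w ≠ μ → T x = w • x → Q x = 0 := by
    intro w x hw hx
    rw [hQ, Submodule.starProjection_apply_eq_zero_iff, Submodule.mem_orthogonal]
    intro e he
    have he' : T e = μ • e := Module.End.mem_eigenspace_iff.1 he
    have := hsymm e x
    simp only [ContinuousLinearMap.coe_coe] at this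
    rw [he', hx, inner_smul_left, inner_smul_right, hreal] at this
    have h2 : (μ - w) * ⟪e, x⟫_ℂ = 0 := by linear_combination this
    exact (mul_eq_zero.1 h2).resolve_left (sub_ne_zero.2 hw.symm)
  have hres : μ ∈ resolventSet ℂ (T + Q) := by
    refine (hTQ.hasEigenvalue_or_mem_resolventSet hμ).resolve_left fun hev' => ?_
    obtain ⟨x, hx⟩ := hev'.exists_hasEigenvector
    have hx1 : T x + Q x = μ • x := hx.apply_eq_smul
    have hQx : Q x = 0 := by
      rw [← inner_self_eq_zero (𝕜 := ℂ)]
      have hm : Q x ∈ V := V.starProjection_apply_mem x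
      have he' : T (Q x) = μ • Q x := Module.End.mem_eigenspace_iff.1 hm
      have h3 := hsymm (Q x) x
      simp only [ContinuousLinearMap.coe_coe] at h3
      rw [he', eq_sub_of_add_eq hx1, inner_smul_left, inner_sub_right, inner_smul_right,
        hreal] at h3
      linear_combination h3
    rw [hQx, add_zero] at hx1
    have hxV : x ∈ V := Module.End.mem_eigenspace_iff.2 hx1
    have : Q x = x := Submodule.starProjection_eq_self_iff.2 hxV
    exact hx.2 (this.symm.trans hQx)
  have h1 : ∀ᶠ w in 𝓝 μ, w ∈ resolventSet ℂ (T + Q) ∧ w ≠ 0 :=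
    ((spectrum.isOpen_resolventSet (T + Q)).eventually_mem hres).and (isOpen_ne.eventually_mem hμ)
  refine eventually_nhdsWithin_iff.2 (h1.mono ?_)
  rintro w ⟨hw, hw0⟩ hwμ hws
  obtain ⟨x, hx⟩ := ((hc.hasEigenvalue_iff_mem_spectrum hw0).2 hws).exists_hasEigenvector
  have hx1 : T x = w • x := hx.apply_eq_smul
  have hQx := horth w x hwμ hx1
  have : w ∈ spectrum ℂ (T + Q) := by
    rw [← hTQ.hasEigenvalue_iff_mem_spectrum hw0]
    refine Module.End.hasEigenvalue_of_hasEigenvector (x := x) ⟨?_, hx.2⟩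
    rw [Module.End.mem_eigenspace_iff]
    simp [hx1, hQx]
  exact this hw

namespace IsSqResolvent

variable {D : E →ₗ.[ℂ] E} {R : E →L[ℂ] E}

/-- The substitution `r = (z + 1)⁻¹` matches the nonzero spectrum of `R` with the spectrum of `D²`,
eigenspaces included, and turns discreteness into the hypotheses of `isCompactOperator_of_isolated`.
-/
theorem isCompactOperator (hR : IsSqResolvent D R) (hD : SymmetricOp D)
    (h : HasDiscreteSpectrum (opSq D)) : IsCompactOperator R := by
  refine isCompactOperator_of_isolated (hR.isSelfAdjoint hD) fun r hr hr0 => ?_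
  have hr0' : (r : ℂ) ≠ 0 := by exact_mod_cast hr0
  set z : ℂ := (r : ℂ)⁻¹ - 1 with hz
  have hz1 : z + 1 = (r : ℂ)⁻¹ := by rw [hz]; ring
  have hz0 : z + 1 ≠ 0 := by rw [hz1]; exact inv_ne_zero hr0'
  have hzr : (z + 1)⁻¹ = r := by rw [hz1, inv_inv]
  have hns : ¬ InResolventSet (opSq D) z := by
    rw [hR.inResolventSet_iff_notMem_spectrum hD hz0, hzr, not_not]
    exact (spectrum.algebraMap_mem_iff ℂ).2 hr
  obtain ⟨-, hfd, hev⟩ := h z hns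
  rw [hR.eigenspace_eq hD hz0, hzr] at hfd
  refine ⟨hfd, ?_⟩
  have htend : Filter.Tendsto (fun w : ℝ => (w : ℂ)⁻¹ - 1) (𝓝[≠] r) (𝓝[≠] z) := by
    refine tendsto_nhdsWithin_iff.2 ⟨?_, ?_⟩
    · refine Filter.Tendsto.mono_left ?_ nhdsWithin_le_nhds
      exact ((Complex.continuous_ofReal.tendsto r).inv₀ hr0').sub_const 1
    · filter_upwards [self_mem_nhdsWithin] with w hw hwz
      refine hw ?_
      have : (w : ℂ)⁻¹ = (r : ℂ)⁻¹ := by simpa [hz] using hwz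
      exact_mod_cast inv_injective this
  have hne : ∀ᶠ w : ℝ in 𝓝[≠] r, w ≠ 0 :=
    Filter.Eventually.filter_mono nhdsWithin_le_nhds (isOpen_ne.mem_nhds hr0)
  filter_upwards [htend.eventually hev, hne] with w hw hw0
  have hw0' : (w : ℂ) ≠ 0 := by exact_mod_cast hw0
  have hw1 : ((w : ℂ)⁻¹ - 1) + 1 = (w : ℂ)⁻¹ := by ring
  rw [hR.inResolventSet_iff_notMem_spectrum hD (by rw [hw1]; exact inv_ne_zero hw0'), hw1,
    inv_inv] at hw
  exact fun hws => hw ((spectrum.algebraMap_mem_iff ℂ).2 hws)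

/-- Outside an isolated set, every point belongs to the resolvent set. -/
theorem eventually_inResolventSet (hR : IsSqResolvent D R) (hD : SymmetricOp D)
    (hc : IsCompactOperator R) {z : ℂ} (hz : z + 1 ≠ 0) :
    ∀ᶠ w in 𝓝[≠] z, InResolventSet (opSq D) w := by
  have h1 := eventually_notMem_spectrum hc (hR.isSelfAdjoint hD) (inv_ne_zero hz)
  have htend : Filter.Tendsto (fun w : ℂ => (w + 1)⁻¹) (𝓝[≠] z) (𝓝[≠] (z + 1)⁻¹) := by
    refine tendsto_nhdsWithin_iff.2 ⟨?_, ?_⟩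
    · refine Filter.Tendsto.mono_left ?_ nhdsWithin_le_nhds
      exact (Filter.Tendsto.add_const 1 Filter.tendsto_id).inv₀ hz
    · filter_upwards [self_mem_nhdsWithin] with w hw hwz
      exact hw (add_right_cancel (inv_injective hwz))
  have hne : ∀ᶠ w in 𝓝[≠] z, w + 1 ≠ 0 :=
    Filter.Eventually.filter_mono nhdsWithin_le_nhds
      ((continuous_id.add continuous_const).continuousAt.eventually_ne hz)
  filter_upwards [htend.eventually h1, hne] with w hw hw0
  exact (hR.inResolventSet_iff_notMem_spectrum hD hw0).2 hw

theorem hasDiscreteSpectrum (hR : IsSqResolvent D R) (hD : SymmetricOp D)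
    (hc : IsCompactOperator R) : HasDiscreteSpectrum (opSq D) := by
  intro z hz
  have hz0 := hR.add_one_ne_zero hD hz
  have hi := inv_ne_zero hz0
  rw [hR.inResolventSet_iff_notMem_spectrum hD hz0, not_not] at hz
  rw [IsEigenvalue, hR.eigenspace_eq hD hz0]
  exact ⟨(hc.hasEigenvalue_iff_mem_spectrum hi).2 hz,
    ContinuousLinearMap.finite_dimensional_eigenspace hc _ hi,
    hR.eventually_inResolventSet hD hc hz0⟩

end IsSqResolvent

end CompactOperators

/-! ### Signed dimension and cancellation of nonzero modes -/

section SignedDimension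

variable {E : Type*} [NormedAddCommGroup E] [InnerProductSpace ℂ E]

/-- The eigenvectors of `θ` in `V` with eigenvalue `ε`. -/
def chiralPart (θ : E →L[ℂ] E) (V : Submodule ℂ E) (ε : ℂ) : Submodule ℂ E :=
  V ⊓ Module.End.eigenspace (θ : Module.End ℂ E) ε

theorem mem_chiralPart {θ : E →L[ℂ] E} {V : Submodule ℂ E} {ε : ℂ} {x : E} :
    x ∈ chiralPart θ V ε ↔ x ∈ V ∧ θ x = ε • x :=
  and_congr_right fun _ => Module.End.mem_eigenspace_iff

instance (θ : E →L[ℂ] E) (V : Submodule ℂ E) [FiniteDimensional ℂ V] (ε : ℂ) :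
    FiniteDimensional ℂ (chiralPart θ V ε) :=
  Submodule.finiteDimensional_of_le inf_le_left

/-- The difference of the numbers of positive and negative chirality directions in `V`. -/
def signedDim (θ : E →L[ℂ] E) (V : Submodule ℂ E) : ℤ :=
  Module.finrank ℂ (chiralPart θ V 1) - Module.finrank ℂ (chiralPart θ V (-1))

/-- `θ` is the difference of the projections `(1 + θ) / 2` and `(1 - θ) / 2` onto its chiral parts,
and the trace of a projection is its rank. -/
theorem trace_restrict_eq_signedDim {θ : E →L[ℂ] E} (hθ : ∀ x, θ (θ x) = x) {V : Submodule ℂ E}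
    [FiniteDimensional ℂ V] (hV : ∀ x ∈ V, (θ : E →ₗ[ℂ] E) x ∈ V) :
    LinearMap.trace ℂ V ((θ : E →ₗ[ℂ] E).restrict hV) = signedDim θ V := by
  set T : V →ₗ[ℂ] V := (θ : E →ₗ[ℂ] E).restrict hV with hT
  have hTT : ∀ x, T (T x) = x := fun x => Subtype.ext (hθ x)
  have hproj : ∀ ε : ℂ, ε * ε = 1 →
      LinearMap.IsProj ((chiralPart θ V ε).comap V.subtype)
        ((2 : ℂ)⁻¹ • (LinearMap.id + ε • T)) := by
    intro ε hε
    refine ⟨fun x => ?_, fun x hx => ?_⟩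
    · rw [Submodule.mem_comap, mem_chiralPart]
      generalize hy : ((2 : ℂ)⁻¹ • (LinearMap.id + ε • T) : V →ₗ[ℂ] V) x = y
      refine ⟨y.2, ?_⟩
      change ((T y : V) : E) = ε • (y : E)
      rw [← Submodule.coe_smul]
      congr 1
      rw [← hy]
      simp only [LinearMap.smul_apply, LinearMap.add_apply, LinearMap.id_apply, map_smul, map_add,
        hTT, smul_add, smul_smul]
      rw [show ε * (2⁻¹ * ε) = 2⁻¹ by linear_combination 2⁻¹ * hε, mul_comm ε, add_comm]
    · rw [Submodule.mem_comap, mem_chiralPart] at hx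
      have h2 : T x = ε • x := Subtype.ext hx.2
      simp only [LinearMap.smul_apply, LinearMap.add_apply, LinearMap.id_apply, h2, smul_smul,
        smul_add, ← add_smul]
      rw [mul_assoc, hε]
      norm_num
  have hfr : ∀ ε : ℂ, Module.finrank ℂ ((chiralPart θ V ε).comap V.subtype) =
      Module.finrank ℂ (chiralPart θ V ε) := fun ε =>
    (Submodule.comapSubtypeEquivOfLe (inf_le_left : chiralPart θ V ε ≤ V)).finrank_eq
  have h1 := (hproj 1 (by norm_num)).trace
  have h2 := (hproj (-1) (by norm_num)).trace
  rw [hfr] at h1 h2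
  have h3 : T = (2 : ℂ)⁻¹ • (LinearMap.id + (1 : ℂ) • T) -
      (2 : ℂ)⁻¹ • (LinearMap.id + (-1 : ℂ) • T) := by module
  rw [h3, map_sub, h1, h2, signedDim]
  push_cast
  rfl

/-- The restriction of an operator to a subspace of its domain. -/
def restrictDomain (D : E →ₗ.[ℂ] E) {V : Submodule ℂ E} (h : V ≤ D.domain) : V →ₗ[ℂ] E :=
  D.toFun ∘ₗ Submodule.inclusion h

theorem mem_graph_restrictDomain (D : E →ₗ.[ℂ] E) {V : Submodule ℂ E} (h : V ≤ D.domain) (x : V) :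
    ((x : E), restrictDomain D h x) ∈ D.graph :=
  D.mem_graph (Submodule.inclusion h x)

theorem SymmetricOp.mem_eigenspace_zero_iff {D : E →ₗ.[ℂ] E} (hD : SymmetricOp D) {x : E} :
    x ∈ eigenspace (IntersectingBranes.opSq D) 0 ↔ (x, 0) ∈ D.graph := by
  rw [mem_eigenspace_iff, zero_smul]
  constructor
  · intro h
    obtain ⟨d, h1, -, h2⟩ := hD.inner_opSq h
    have : d = 0 := by
      rw [inner_zero_right] at h2
      have h3 : ‖d‖ ^ 2 = 0 := by exact_mod_cast h2.symm
      simpa using h3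
    rwa [this] at h1
  · exact fun h => mem_graph_opSq.2 ⟨0, h, D.graph.zero_mem⟩

theorem AnticommutesWith.mem_chiralPart_neg {θ : E →L[ℂ] E} {D : E →ₗ.[ℂ] E}
    (h : AnticommutesWith θ D) {V : Submodule ℂ E} (hV : ∀ x ∈ V, ∃ y ∈ V, (x, y) ∈ D.graph)
    {ε : ℂ} {x y : E} (hx : x ∈ chiralPart θ V ε) (hxy : (x, y) ∈ D.graph) :
    y ∈ chiralPart θ V (-ε) := by
  rw [mem_chiralPart] at hx ⊢
  obtain ⟨y', hy', hxy'⟩ := hV x hx.1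
  obtain rfl := graph_unique hxy hxy'
  refine ⟨hy', ?_⟩
  have h1 := h x y hxy
  rw [hx.2] at h1
  have h2 := graph_unique h1 (D.graph.smul_mem ε hxy)
  rw [neg_smul, ← h2, neg_neg]

/-- `D` itself is the injection between the two ranges: if `D (D x) = 0`, then `x` lies in `ker D² =
ker D`, so `D x = 0`. Applied to both signs it gives equality. -/
theorem finrank_range_chiralPart_le {θ : E →L[ℂ] E} {D : E →ₗ.[ℂ] E} (hD : SymmetricOp D)
    (hθ : AnticommutesWith θ D) {V : Submodule ℂ E} [FiniteDimensional ℂ V]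
    (hV : ∀ x ∈ V, ∃ y ∈ V, (x, y) ∈ D.graph) {ε ε' : ℂ} (hε : ε' = -ε)
    (h : chiralPart θ V ε ≤ D.domain) (h' : chiralPart θ V ε' ≤ D.domain) :
    Module.finrank ℂ (LinearMap.range (restrictDomain D h)) ≤
      Module.finrank ℂ (LinearMap.range (restrictDomain D h')) := by
  have hle : LinearMap.range (restrictDomain D h) ≤ chiralPart θ V ε' := by
    rintro _ ⟨x, rfl⟩
    rw [hε]
    exact hθ.mem_chiralPart_neg hV x.2 (mem_graph_restrictDomain D h x)
  have hmem : ∀ y : LinearMap.range (restrictDomain D h),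
      restrictDomain D h' (Submodule.inclusion hle y) ∈ LinearMap.range (restrictDomain D h') :=
    fun y => ⟨_, rfl⟩
  refine LinearMap.finrank_le_finrank_of_injective
    (f := ((restrictDomain D h') ∘ₗ Submodule.inclusion hle).codRestrict _ hmem) ?_
  rw [injective_iff_map_eq_zero]
  rintro ⟨y, x, rfl⟩ hy
  have h1 : restrictDomain D h' (Submodule.inclusion hle ⟨_, x, rfl⟩) = 0 :=
    congrArg Subtype.val hy
  have h2 := mem_graph_restrictDomain D h' (Submodule.inclusion hle ⟨_, x, rfl⟩)
  rw [h1] at h2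
  have h3 := mem_graph_restrictDomain D h x
  have h4 : (x : E) ∈ eigenspace (opSq D) 0 := by
    rw [mem_eigenspace_iff, zero_smul]
    exact mem_graph_opSq.2 ⟨_, h3, h2⟩
  rw [hD.mem_eigenspace_zero_iff] at h4
  exact Subtype.ext (graph_unique h3 h4)

/-- Rank-nullity for `D` on a chiral part; as `V` contains all zero modes, the kernel does not
depend on `V`. -/
theorem finrank_chiralPart {θ : E →L[ℂ] E} {D : E →ₗ.[ℂ] E} (hD : SymmetricOp D)
    {V : Submodule ℂ E} [FiniteDimensional ℂ V] (h0 : eigenspace (opSq D) 0 ≤ V) (ε : ℂ)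
    (h : chiralPart θ V ε ≤ D.domain) :
    Module.finrank ℂ (chiralPart θ V ε) = Module.finrank ℂ (LinearMap.range (restrictDomain D h)) +
      Module.finrank ℂ (chiralPart θ (eigenspace (opSq D) 0) ε) := by
  rw [← LinearMap.finrank_range_add_finrank_ker (restrictDomain D h)]
  congr 1
  have : (LinearMap.ker (restrictDomain D h)).map (chiralPart θ V ε).subtype =
      chiralPart θ (eigenspace (opSq D) 0) ε := by
    ext x
    simp only [Submodule.mem_map, LinearMap.mem_ker, Submodule.subtype_apply, Subtype.exists,
      exists_and_right, exists_eq_right]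
    refine Iff.trans ?_ (mem_chiralPart.trans (and_congr_left' hD.mem_eigenspace_zero_iff)).symm
    constructor
    · rintro ⟨hx, hx0⟩
      have := mem_graph_restrictDomain D h ⟨x, hx⟩
      rw [hx0] at this
      exact ⟨this, (mem_chiralPart.1 hx).2⟩
    · rintro ⟨hx, hxε⟩
      have hxV : x ∈ chiralPart θ V ε :=
        mem_chiralPart.2 ⟨h0 (hD.mem_eigenspace_zero_iff.2 hx), hxε⟩
      exact ⟨hxV, graph_unique (mem_graph_restrictDomain D h ⟨x, hxV⟩) hx⟩
  rw [← this]
  exact (Submodule.equivMapOfInjective _ (Submodule.subtype_injective _) _).finrank_eq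

/-- On a finite-dimensional subspace invariant under `D` the nonzero modes of `D` cancel in pairs
of opposite chirality. -/
theorem signedDim_eq_signedDim_ker {θ : E →L[ℂ] E} {D : E →ₗ.[ℂ] E} (hD : SymmetricOp D)
    (hθ : AnticommutesWith θ D) {V : Submodule ℂ E} [FiniteDimensional ℂ V]
    (hV : ∀ x ∈ V, ∃ y ∈ V, (x, y) ∈ D.graph) (h0 : eigenspace (opSq D) 0 ≤ V) :
    signedDim θ V = signedDim θ (eigenspace (opSq D) 0) := by
  have hdom : ∀ ε, chiralPart θ V ε ≤ D.domain := by
    intro ε x hx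
    obtain ⟨y, -, hy⟩ := hV x hx.1
    exact LinearPMap.mem_domain_of_mem_graph hy
  have h1 := finrank_range_chiralPart_le hD hθ hV rfl (hdom 1) (hdom (-1))
  have h2 := finrank_range_chiralPart_le hD hθ hV (neg_neg 1).symm (hdom (-1)) (hdom 1)
  have e1 := finrank_chiralPart (θ := θ) hD h0 1 (hdom _)
  have e2 := finrank_chiralPart (θ := θ) hD h0 (-1) (hdom _)
  simp only [signedDim]
  omega

/-- `P` and `Q` need not be inverse to each other: preserving chirality and being injective, they
bound each chiral dimension from both sides. -/
theorem signedDim_eq_of_injOn {θ P Q : E →L[ℂ] E} {V W : Submodule ℂ E} [FiniteDimensional ℂ V]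
    [FiniteDimensional ℂ W] (hPθ : Commute P θ) (hQθ : Commute Q θ)
    (hP : ∀ x ∈ V, P x ∈ W) (hP0 : ∀ x ∈ V, P x = 0 → x = 0)
    (hQ : ∀ x ∈ W, Q x ∈ V) (hQ0 : ∀ x ∈ W, Q x = 0 → x = 0) :
    signedDim θ V = signedDim θ W := by
  have key : ∀ (P : E →L[ℂ] E) (V W : Submodule ℂ E) [FiniteDimensional ℂ W], Commute P θ →
      (∀ x ∈ V, P x ∈ W) → (∀ x ∈ V, P x = 0 → x = 0) → ∀ ε,
      Module.finrank ℂ (chiralPart θ V ε) ≤ Module.finrank ℂ (chiralPart θ W ε) := by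
    intro P V W _ hPθ hP hP0 ε
    have hm : ∀ x : chiralPart θ V ε,
        ((P : E →ₗ[ℂ] E) ∘ₗ (chiralPart θ V ε).subtype) x ∈ chiralPart θ W ε := by
      intro x
      obtain ⟨h1, h2⟩ := mem_chiralPart.1 x.2
      refine mem_chiralPart.2 ⟨hP _ h1, ?_⟩
      have := congrArg (fun A : E →L[ℂ] E => A x) hPθ.eq
      simp only [mul_apply_eq_comp] at this
      rw [h2, map_smul] at this
      exact this.symm
    refine LinearMap.finrank_le_finrank_of_injective (f := LinearMap.codRestrict _ _ hm) ?_
    rw [injective_iff_map_eq_zero]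
    intro x hx
    exact Subtype.ext (hP0 _ (mem_chiralPart.1 x.2).1 (congrArg Subtype.val hx))
  have a := fun ε => le_antisymm (key P V W hPθ hP hP0 ε) (key Q W V hQθ hQ hQ0 ε)
  simp only [signedDim, a]

end SignedDimension

/-! ### Traces over arbitrary orthonormal bases -/

section Trace

universe u

variable {E : Type u} [NormedAddCommGroup E] [InnerProductSpace ℂ E] [CompleteSpace E]

/-- Expanding the projector in a finite orthonormal basis of `V` leaves finitely many rank-one
terms, each summed by Parseval. -/
theorem hasTrace_starProjection_comp (θ : E →L[ℂ] E) (V : Submodule ℂ E) [FiniteDimensional ℂ V]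
    (hV : ∀ x ∈ V, (θ : E →ₗ[ℂ] E) x ∈ V) :
    HasTrace (V.starProjection ∘L θ) (LinearMap.trace ℂ V ((θ : E →ₗ[ℂ] E).restrict hV)) := by
  intro ι b
  set e := stdOrthonormalBasis ℂ V
  have h1 : ∀ i, ⟪b i, (V.starProjection ∘L θ) (b i)⟫_ℂ =
      ∑ k, ⟪(ContinuousLinearMap.adjoint θ) (e k : E), b i⟫_ℂ * ⟪b i, (e k : E)⟫_ℂ := by
    intro i
    rw [e.starProjection_eq_sum_rankOne]
    simp only [ContinuousLinearMap.comp_apply, sum_apply,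
      InnerProductSpace.rankOne_apply, inner_sum, inner_smul_right,
      ContinuousLinearMap.adjoint_inner_left]
  have h2 : LinearMap.trace ℂ V ((θ : E →ₗ[ℂ] E).restrict hV) =
      ∑ k, ⟪(ContinuousLinearMap.adjoint θ) (e k : E), (e k : E)⟫_ℂ := by
    rw [LinearMap.trace_eq_sum_inner _ e]
    refine Finset.sum_congr rfl fun k _ => ?_
    rw [ContinuousLinearMap.adjoint_inner_left]
    rfl
  simp only [h1]
  rw [h2]
  exact hasSum_sum fun k _ => b.hasSum_inner_mul_inner _ _

theorem starProjection_topologicalClosure (V : Submodule ℂ E) [FiniteDimensional ℂ V] :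
    V.topologicalClosure.starProjection = V.starProjection := by
  have h : V.topologicalClosure = V := V.closed_of_finiteDimensional.submodule_topologicalClosure_eq
  ext x
  refine (Submodule.eq_starProjection_of_mem_orthogonal ?_ ?_).symm
  · exact h.le (V.topologicalClosure.starProjection_apply_mem x)
  · exact Submodule.orthogonal_le h.ge
      (Submodule.sub_starProjection_mem_orthogonal (K := V.topologicalClosure) x)

end Trace

/-! ### Spectral subspaces of the resolvent above a cutoff -/

section SpectralCutoff

variable {E : Type*} [NormedAddCommGroup E] [InnerProductSpace ℂ E]

theorem re_mul_inner_self (r : ℝ) (x : E) : ((r : ℂ) * ⟪x, x⟫_ℂ).re = r * ‖x‖ ^ 2 := by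
  rw [Complex.re_ofReal_mul]
  exact congrArg (r * ·) (inner_self_eq_norm_sq (𝕜 := ℂ) x)

theorem continuousOn_cut {T : E →L[ℂ] E} {c : ℝ} (hc : c ∉ spectrum ℝ T) :
    ContinuousOn (fun x : ℝ => if c ≤ x then (1 : ℝ) else 0) (spectrum ℝ T) := by
  intro x hx
  have hxc : x ≠ c := fun h => hc (h ▸ hx)
  refine (tendsto_const_nhds (x := if c ≤ x then (1 : ℝ) else 0)).congr' ?_
  refine Filter.Eventually.filter_mono nhdsWithin_le_nhds ?_
  rcases lt_or_gt_of_ne hxc with h | h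
  · filter_upwards [isOpen_Iio.eventually_mem h] with y hy
    rw [if_neg (not_le.2 h), if_neg (not_le.2 hy)]
  · filter_upwards [isOpen_Ioi.eventually_mem h] with y hy
    rw [if_pos h.le, if_pos (le_of_lt hy)]

/-- `J = D R` is bounded because `‖D R y‖² = ⟪R y, y - R y⟫`. It commutes with `R` because `(D² + 1)
J R y = J y`. -/
theorem IsSqResolvent.exists_comp {D : E →ₗ.[ℂ] E} {R : E →L[ℂ] E}
    (hR : IsSqResolvent D R) (hD : SymmetricOp D) :
    ∃ J : E →L[ℂ] E, (∀ y, (R y, J y) ∈ D.graph) ∧ Commute R J := by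
  choose d h1 h2 h3 using fun y => hD.inner_opSq (hR y)
  let J₀ : E →ₗ[ℂ] E :=
    { toFun := d
      map_add' := fun x y => by
        have := D.graph.add_mem (h1 x) (h1 y)
        rw [Prod.mk_add_mk, ← map_add] at this
        exact graph_unique (h1 _) this
      map_smul' := fun c x => by
        have := D.graph.smul_mem c (h1 x)
        rw [Prod.smul_mk, ← map_smul] at this
        exact graph_unique (h1 _) this }
  have hb : ∀ y, ‖J₀ y‖ ≤ (‖R‖ + 1) * ‖y‖ := by
    intro y
    change ‖d y‖ ≤ _
    have e1 : ‖d y‖ ^ 2 ≤ ‖R y‖ * ‖y - R y‖ := by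
      have := norm_inner_le_norm (𝕜 := ℂ) (R y) (y - R y)
      rw [h3 y, Complex.norm_real, Real.norm_eq_abs, abs_of_nonneg (sq_nonneg _)] at this
      exact this
    have e2 : ‖R y‖ ≤ ‖R‖ * ‖y‖ := R.le_opNorm y
    have e3 : ‖y - R y‖ ≤ (‖R‖ + 1) * ‖y‖ := by
      refine (norm_sub_le _ _).trans ?_
      linarith
    have e4 : ‖R y‖ ≤ (‖R‖ + 1) * ‖y‖ := by linarith [norm_nonneg y]
    refine le_of_sq_le_sq ?_ (by positivity)
    calc ‖d y‖ ^ 2 ≤ ‖R y‖ * ‖y - R y‖ := e1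
      _ ≤ ((‖R‖ + 1) * ‖y‖) * ((‖R‖ + 1) * ‖y‖) := by gcongr
      _ = _ := by ring
  refine ⟨J₀.mkContinuous _ hb, h1, ?_⟩
  ext y
  change R (d y) = d (R y)
  have e1 := D.graph.sub_mem (h1 y) (h1 (R y))
  have e2 : (d (R y), d y - d (R y)) ∈ (opSq D).graph :=
    mem_graph_opSq.2 ⟨_, h2 (R y), e1⟩
  have := hR.apply_add hD e2
  rwa [sub_add_cancel] at this

variable [CompleteSpace E]

theorem eventually_notMem_spectrum_real {T : E →L[ℂ] E} (hc : IsCompactOperator T)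
    (hT : IsSelfAdjoint T) {r : ℝ} (hr : r ≠ 0) : ∀ᶠ w in 𝓝[≠] r, w ∉ spectrum ℝ T := by
  have h := eventually_notMem_spectrum hc hT (μ := (r : ℂ)) (by exact_mod_cast hr)
  have htend : Filter.Tendsto (fun w : ℝ => (w : ℂ)) (𝓝[≠] r) (𝓝[≠] (r : ℂ)) := by
    refine tendsto_nhdsWithin_iff.2
      ⟨(Complex.continuous_ofReal.tendsto r).mono_left nhdsWithin_le_nhds, ?_⟩
    filter_upwards [self_mem_nhdsWithin] with w hw hwz
    exact hw (Complex.ofReal_injective hwz)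
  exact (htend.eventually h).mono fun w hw hws => hw ((spectrum.algebraMap_mem_iff ℂ).2 hws)

/-- The spectral projection of `T` onto the part of the spectrum above `c`. -/
def cutProj (T : E →L[ℂ] E) (c : ℝ) : E →L[ℂ] E :=
  cfc (fun x : ℝ => if c ≤ x then (1 : ℝ) else 0) T

/-- The range of the spectral projection `cutProj T c`. -/
def cutSpace (T : E →L[ℂ] E) (c : ℝ) : Submodule ℂ E :=
  Module.End.eigenspace (cutProj T c : Module.End ℂ E) 1

theorem mem_cutSpace {T : E →L[ℂ] E} {c : ℝ} {x : E} :
    x ∈ cutSpace T c ↔ cutProj T c x = x := by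
  rw [cutSpace, Module.End.mem_eigenspace_iff, one_smul]
  rfl

theorem Commute.cutProj {T B : E →L[ℂ] E} (h : Commute T B) (c : ℝ) :
    Commute (cutProj T c) B :=
  h.cfc_real _

theorem cutProj_mul_self {T : E →L[ℂ] E} {c : ℝ} (hc : c ∉ spectrum ℝ T) :
    cutProj T c * cutProj T c = cutProj T c := by
  rw [cutProj, ← cfc_mul _ _ T (continuousOn_cut hc) (continuousOn_cut hc)]
  refine cfc_congr fun x _ => ?_
  by_cases h : c ≤ x <;> simp [h]

theorem cutProj_apply_mem {T : E →L[ℂ] E} {c : ℝ} (hc : c ∉ spectrum ℝ T) (x : E) :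
    cutProj T c x ∈ cutSpace T c := by
  rw [mem_cutSpace, ← mul_apply_eq_comp, cutProj_mul_self hc]

/-- Functional calculus makes `(T - (c + ε)) * cutProj T c` nonnegative. The margin `ε` is used for
the unperturbed resolvent and set to `0` for the perturbed one. -/
theorem le_re_inner_of_mem_cutSpace {T : E →L[ℂ] E} (hT : IsSelfAdjoint T) {c ε : ℝ}
    (hc : c ∉ spectrum ℝ T) (hε : ∀ r ∈ spectrum ℝ T, c ≤ r → c + ε ≤ r) {x : E}
    (hx : x ∈ cutSpace T c) : (c + ε) * ‖x‖ ^ 2 ≤ (⟪x, T x⟫_ℂ).re := by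
  have h0 : 0 ≤ (T - algebraMap ℝ (E →L[ℂ] E) (c + ε)) * cutProj T c := by
    nth_rw 1 [← cfc_id' ℝ T]
    rw [cutProj, ← cfc_const (c + ε) T, ← cfc_sub _ _ T (by fun_prop) (by fun_prop),
      ← cfc_mul _ _ T (by fun_prop) (continuousOn_cut hc)]
    refine cfc_nonneg fun r hr => ?_
    by_cases h : c ≤ r
    · simp only [h, if_true, mul_one]
      linarith [hε r hr h]
    · simp [h]
  have h1 := ((ContinuousLinearMap.nonneg_iff_isPositive _).1 h0).re_inner_nonneg_right x
  rw [mem_cutSpace] at hx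
  rw [mul_apply_eq_comp, hx, sub_apply, inner_sub_right, Algebra.algebraMap_eq_smul_one,
    smul_apply, one_apply_eq_self, inner_smul_right_eq_smul, map_sub] at h1
  have h2 : RCLike.re ((c + ε) • ⟪x, x⟫_ℂ) = (c + ε) * ‖x‖ ^ 2 := by
    rw [← Complex.coe_smul, smul_eq_mul]
    exact re_mul_inner_self _ x
  rw [h2] at h1
  exact sub_nonneg.1 h1

theorem re_inner_le_of_cutProj_eq_zero {T : E →L[ℂ] E} (hT : IsSelfAdjoint T) {c ε : ℝ}
    (hc : c ∉ spectrum ℝ T) (hε : ∀ r ∈ spectrum ℝ T, r < c → r ≤ c - ε) {x : E}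
    (hx : cutProj T c x = 0) : (⟪x, T x⟫_ℂ).re ≤ (c - ε) * ‖x‖ ^ 2 := by
  have h0 : 0 ≤ (algebraMap ℝ (E →L[ℂ] E) (c - ε) - T) * (1 - cutProj T c) := by
    nth_rw 1 [← cfc_id' ℝ T]
    rw [cutProj, ← cfc_const (c - ε) T, ← cfc_const_one ℝ T,
      ← cfc_sub _ _ T (by fun_prop) (by fun_prop),
      ← cfc_sub _ _ T (by fun_prop) (continuousOn_cut hc),
      ← cfc_mul _ (fun r : ℝ => 1 - if c ≤ r then (1 : ℝ) else 0) T (by fun_prop)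
        (continuousOn_const.sub (continuousOn_cut hc))]
    refine cfc_nonneg fun r hr => ?_
    by_cases h : c ≤ r
    · simp [h]
    · simp only [h, if_false, sub_zero, mul_one]
      linarith [hε r hr (not_le.1 h)]
  have h1 := ((ContinuousLinearMap.nonneg_iff_isPositive _).1 h0).re_inner_nonneg_right x
  rw [mul_apply_eq_comp, sub_apply (1 : E →L[ℂ] E), hx, sub_zero, one_apply_eq_self, sub_apply,
    inner_sub_right, Algebra.algebraMap_eq_smul_one,
    smul_apply, one_apply_eq_self, inner_smul_right_eq_smul, map_sub] at h1
  have h2 : RCLike.re ((c - ε) • ⟪x, x⟫_ℂ) = (c - ε) * ‖x‖ ^ 2 := by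
    rw [← Complex.coe_smul, smul_eq_mul]
    exact re_mul_inner_self _ x
  rw [h2] at h1
  exact sub_nonneg.1 h1

theorem exists_cutProj_eq_mul {T : E →L[ℂ] E} (hT : IsSelfAdjoint T) {c : ℝ} (hc0 : 0 < c)
    (hc : c ∉ spectrum ℝ T) : ∃ G : E →L[ℂ] E, cutProj T c = T * G ∧
      Commute G (cutProj T c) := by
  -- `max c x` agrees with `x` where the cutoff is nonzero and stays away from `0`, so the quotient
  -- is continuous on the spectrum.
  have hcont : ContinuousOn (fun x : ℝ => (if c ≤ x then (1 : ℝ) else 0) * (max c x)⁻¹)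
      (spectrum ℝ T) :=
    (continuousOn_cut hc).mul (Continuous.continuousOn
      ((continuous_const.max continuous_id).inv₀ fun x => (lt_max_of_lt_left hc0).ne'))
  refine ⟨cfc (fun x : ℝ => (if c ≤ x then (1 : ℝ) else 0) * (max c x)⁻¹) T, ?_, ?_⟩
  · nth_rw 2 [← cfc_id' ℝ T]
    rw [← cfc_mul _ _ T (by fun_prop) hcont]
    refine cfc_congr fun x _ => ?_
    by_cases h : c ≤ x
    · have : x ≠ 0 := (hc0.trans_le h).ne'
      simp [h, this]
    · simp [h]
  · exact cfc_commute_cfc _ _ T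

theorem isCompactOperator_cutProj {T : E →L[ℂ] E} (hT : IsSelfAdjoint T)
    (hcomp : IsCompactOperator T) {c : ℝ} (hc0 : 0 < c) (hc : c ∉ spectrum ℝ T) :
    IsCompactOperator (cutProj T c) := by
  obtain ⟨G, hG, -⟩ := exists_cutProj_eq_mul hT hc0 hc
  rw [hG]
  exact hcomp.comp_clm G

theorem finiteDimensional_cutSpace {T : E →L[ℂ] E} (hT : IsSelfAdjoint T)
    (hcomp : IsCompactOperator T) {c : ℝ} (hc0 : 0 < c) (hc : c ∉ spectrum ℝ T) :
    FiniteDimensional ℂ (cutSpace T c) :=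
  ContinuousLinearMap.finite_dimensional_eigenspace
    (isCompactOperator_cutProj hT hcomp hc0 hc) 1 one_ne_zero

/-- The part of `x` killed by the projection still satisfies the eigenvalue equation with `r > c`,
while the quadratic form of `T` is at most `c` there; so that part vanishes. -/
theorem mem_cutSpace_of_apply_eq_smul {T : E →L[ℂ] E} (hT : IsSelfAdjoint T) {c r : ℝ}
    (hc : c ∉ spectrum ℝ T) (hr : c < r) {x : E} (hx : T x = (r : ℂ) • x) :
    x ∈ cutSpace T c := by
  have hcomm : ∀ y, T (cutProj T c y) = cutProj T c (T y) := fun y =>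
    (congrArg (fun A : E →L[ℂ] E => A y) (Commute.cutProj (Commute.refl T) c).eq).symm
  set y := x - cutProj T c x with hy
  have hy0 : cutProj T c y = 0 := by
    rw [hy, map_sub, mem_cutSpace.1 (cutProj_apply_mem hc x), sub_self]
  have hTy : T y = (r : ℂ) • y := by
    rw [hy, map_sub, hcomm, hx, map_smul, smul_sub]
  have h1 := re_inner_le_of_cutProj_eq_zero hT (ε := 0) hc
    (fun s _ h => by rw [sub_zero]; exact h.le) hy0
  have h2 : (⟪y, T y⟫_ℂ).re = r * ‖y‖ ^ 2 := by
    rw [hTy, inner_smul_right, re_mul_inner_self]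
  rw [h2, sub_zero] at h1
  have h3 : ‖y‖ ^ 2 = 0 := le_antisymm (by nlinarith [sq_nonneg ‖y‖]) (sq_nonneg _)
  have h4 : y = 0 := by simpa using h3
  exact mem_cutSpace.2 (sub_eq_zero.1 h4).symm

namespace IsSqResolvent

variable {D : E →ₗ.[ℂ] E} {R : E →L[ℂ] E}

/-- Above `c` the resolvent can be inverted: `x = R G x`, whence `D x = J G x`, and both `J` and `G`
commute with the cutoff. -/
theorem exists_mem_cutSpace (hR : IsSqResolvent D R) (hD : SymmetricOp D) {c : ℝ} (hc0 : 0 < c)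
    (hc : c ∉ spectrum ℝ R) : ∀ x ∈ cutSpace R c, ∃ y ∈ cutSpace R c, (x, y) ∈ D.graph := by
  intro x hx
  obtain ⟨J, hJ, hRJ⟩ := hR.exists_comp hD
  obtain ⟨G, hG, hGP⟩ := exists_cutProj_eq_mul (hR.isSelfAdjoint hD) hc0 hc
  have hx' := mem_cutSpace.1 hx
  have h1 := hJ (G x)
  have h2 : R (G x) = x := by rw [← mul_apply_eq_comp, ← hG, hx']
  rw [h2] at h1
  refine ⟨_, ?_, h1⟩
  rw [mem_cutSpace]
  have h3 : cutProj R c * J * G = J * G * cutProj R c := by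
    rw [(Commute.cutProj hRJ c).eq, mul_assoc, ← hGP.eq, mul_assoc]
  have h4 := congrArg (fun A : E →L[ℂ] E => A x) h3
  simpa [hx'] using h4

theorem eigenspace_le_cutSpace (hR : IsSqResolvent D R) (hD : SymmetricOp D) {c M : ℝ}
    (hM : 0 ≤ M) (hc : c ∉ spectrum ℝ R) (hcM : c * (M + 1) < 1) {z : ℂ} (hz : ‖z‖ ≤ M) :
    eigenspace (opSq D) z ≤ cutSpace R c := by
  intro x hx
  by_cases hx0 : x = 0
  · rw [hx0]; exact Submodule.zero_mem _
  obtain ⟨d, -, -, hd⟩ := hD.inner_opSq (IntersectingBranes.mem_eigenspace_iff.1 hx)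
  rw [inner_smul_right, inner_self_eq_norm_sq_to_K] at hd
  have hn : 0 < ‖x‖ ^ 2 := by positivity
  have hn' : ((‖x‖ : ℝ) : ℂ) ^ 2 ≠ 0 := by exact_mod_cast hn.ne'
  -- The Rayleigh quotient shows that `z` is real and nonnegative; then `(r + 1)⁻¹ ≥ (M + 1)⁻¹ > c`
  -- is the eigenvalue of `R` at `x`.
  set r : ℝ := ‖d‖ ^ 2 / ‖x‖ ^ 2 with hr
  have hr0 : 0 ≤ r := by positivity
  have hzr : z = r := by
    rw [hr, Complex.ofReal_div]
    refine (eq_div_iff ?_).2 ?_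
    · exact_mod_cast hn.ne'
    · push_cast at hd ⊢
      exact hd
  have hrM : r ≤ M := by
    rwa [hzr, Complex.norm_real, Real.norm_eq_abs, abs_of_nonneg hr0] at hz
  rw [hR.mem_eigenspace_iff hD, hzr] at hx
  have hr1 : (r : ℂ) + 1 ≠ 0 := by
    have : r + 1 ≠ 0 := by positivity
    exact_mod_cast this
  refine mem_cutSpace_of_apply_eq_smul (hR.isSelfAdjoint hD) (r := (r + 1)⁻¹) hc ?_ ?_
  · rw [← one_div, lt_div_iff₀ (by positivity)]
    rcases le_total 0 c with h | h
    · nlinarith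
    · nlinarith
  · push_cast
    rw [eq_inv_smul_iff₀ hr1]
    exact hx

theorem signedDim_cutSpace (hR : IsSqResolvent D R) (hD : SymmetricOp D)
    (hcomp : IsCompactOperator R) {θ : E →L[ℂ] E} (hθ : AnticommutesWith θ D) {c : ℝ}
    (hc0 : 0 < c) (hc1 : c < 1) (hc : c ∉ spectrum ℝ R) :
    signedDim θ (cutSpace R c) = signedDim θ (eigenspace (opSq D) 0) := by
  have := finiteDimensional_cutSpace (hR.isSelfAdjoint hD) hcomp hc0 hc
  exact signedDim_eq_signedDim_ker hD hθ (hR.exists_mem_cutSpace hD hc0 hc)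
    (hR.eigenspace_le_cutSpace hD le_rfl hc (by simpa using hc1) (by simp))

theorem exists_cutSpace_ge (hR : IsSqResolvent D R) (hD : SymmetricOp D)
    (hcomp : IsCompactOperator R) {M : ℝ} (hM : 0 ≤ M) :
    ∃ c : ℝ, 0 < c ∧ c ∉ spectrum ℝ R ∧ c * (M + 1) < 1 := by
  have hM1 : 0 < M + 1 := by positivity
  -- Any positive point below `(M + 1)⁻¹` would do: the spectrum is isolated near it, so a nearby
  -- `c` avoids the spectrum.
  have h0 : (0 : ℝ) < (2 * (M + 1))⁻¹ := by positivity
  have h1 := eventually_notMem_spectrum_real hcomp (hR.isSelfAdjoint hD) h0.ne'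
  have h2 : ∀ᶠ w in 𝓝[≠] (2 * (M + 1))⁻¹, w ∈ Set.Ioo 0 (M + 1)⁻¹ := by
    refine Filter.Eventually.filter_mono nhdsWithin_le_nhds (isOpen_Ioo.eventually_mem ⟨h0, ?_⟩)
    exact inv_strictAnti₀ hM1 (by linarith)
  obtain ⟨c, hc, hc0, hc1⟩ := (h1.and h2).exists
  refine ⟨c, hc0, hc, ?_⟩
  rwa [← one_div, lt_div_iff₀ hM1] at hc1

end IsSqResolvent

end SpectralCutoff

/-! ### Contours, the index and its stability -/

section ChiralityIndex

/-- From a point outside a disc containing the curve, the outward ray misses the curve, so the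
component of that point is unbounded. -/
theorem ClosedCurve.exists_norm_le_of_encircles (Γ : ClosedCurve) :
    ∃ M : ℝ, 0 ≤ M ∧ ∀ z, Γ.Encircles z → ‖z‖ ≤ M := by
  obtain ⟨M, hM, hΓ⟩ := (isCompact_range Γ.continuous').isBounded.exists_pos_norm_le
  refine ⟨M, hM.le, fun z hz => ?_⟩
  by_contra! hlt
  have hz0 : 0 < ‖z‖ := hM.trans hlt
  set ray : Set ℂ := (fun s : ℝ => (s : ℂ) * z) '' Set.Ici 1 with hray
  have hpre : IsPreconnected ray :=
    isPreconnected_Ici.image _ (by fun_prop)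
  have hsub : ray ⊆ Γ.imageᶜ := by
    rintro _ ⟨s, hs, rfl⟩ hmem
    have h1 := hΓ _ hmem
    rw [norm_mul, Complex.norm_real, Real.norm_eq_abs,
      abs_of_nonneg (zero_le_one.trans (Set.mem_Ici.1 hs))] at h1
    nlinarith [Set.mem_Ici.1 hs]
  have hzr : z ∈ ray := ⟨1, Set.mem_Ici.2 le_rfl, by simp⟩
  obtain ⟨C, hC, hb⟩ := (hz.2.subset
    (hpre.subset_connectedComponentIn hzr hsub)).exists_pos_norm_le
  have hs : (1 : ℝ) ≤ 1 + C / ‖z‖ := by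
    have : 0 ≤ C / ‖z‖ := by positivity
    linarith
  have h2 := hb _ ⟨1 + C / ‖z‖, hs, rfl⟩
  rw [norm_mul, Complex.norm_real, Real.norm_eq_abs, abs_of_nonneg (zero_le_one.trans hs), add_mul,
    div_mul_cancel₀ _ hz0.ne'] at h2
  linarith

/-- The circle of radius `r` around the origin. -/
def ClosedCurve.circle (r : ℝ) (hr : 0 < r) : ClosedCurve where
  toFun w := (r : ℂ) * w
  continuous' := continuous_const.mul continuous_subtype_val
  injective' := fun w w' h =>
    Subtype.ext (mul_left_cancel₀ (by exact_mod_cast hr.ne') h)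

theorem ClosedCurve.mem_circle_image {r : ℝ} {hr : 0 < r} {z : ℂ} :
    z ∈ (ClosedCurve.circle r hr).image ↔ ‖z‖ = r := by
  constructor
  · rintro ⟨w, rfl⟩
    change ‖(r : ℂ) * w‖ = r
    rw [norm_mul, Circle.norm_coe, mul_one, Complex.norm_real, Real.norm_eq_abs, abs_of_pos hr]
  · intro h
    have hr' : (r : ℂ) ≠ 0 := by exact_mod_cast hr.ne'
    refine ⟨⟨z / r, mem_sphere_zero_iff_norm.2 ?_⟩, ?_⟩
    · rw [norm_div, h, Complex.norm_real, Real.norm_eq_abs, abs_of_pos hr, div_self hr.ne']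
    · change (r : ℂ) * (z / r) = z
      field_simp

/-- The norm maps the component of `0` onto an interval containing `0`; reaching norm `r` or more
would force it through the circle. -/
theorem ClosedCurve.circle_encircles_zero {r : ℝ} (hr : 0 < r) :
    (ClosedCurve.circle r hr).Encircles 0 := by
  have h0 : (0 : ℂ) ∉ (ClosedCurve.circle r hr).image := by
    rw [ClosedCurve.mem_circle_image, norm_zero]
    exact hr.ne
  refine ⟨h0, (Metric.isBounded_ball (x := (0 : ℂ)) (r := r)).subset fun w hw => ?_⟩
  rw [mem_ball_zero_iff]
  by_contra! hlt
  have hpre := (isPreconnected_connectedComponentIn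
    (x := (0 : ℂ)) (F := (ClosedCurve.circle r hr).imageᶜ)).image _ continuous_norm.continuousOn
  have h1 : (0 : ℝ) ∈ norm '' connectedComponentIn (ClosedCurve.circle r hr).imageᶜ (0 : ℂ) :=
    ⟨0, mem_connectedComponentIn h0, norm_zero⟩
  obtain ⟨u, hu, hur⟩ := hpre.ordConnected.out h1 ⟨w, hw, rfl⟩ ⟨hr.le, hlt⟩
  exact connectedComponentIn_subset _ _ hu (ClosedCurve.mem_circle_image.2 hur)

theorem InResolventSet.not_isEigenvalue {E : Type*} [NormedAddCommGroup E] [InnerProductSpace ℂ E]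
    {A : E →ₗ.[ℂ] E} {z : ℂ} (h : InResolventSet A z) : ¬ IsEigenvalue A z := by
  rw [IsEigenvalue, not_not, Submodule.eq_bot_iff]
  intro x hx
  obtain ⟨R, -, hR⟩ := inResolventSet_iff.1 h
  have := hR _ _ (mem_eigenspace_iff.1 hx)
  rwa [sub_self, map_zero, eq_comm] at this

section EigenspaceSpan

variable {E : Type*} [NormedAddCommGroup E] [InnerProductSpace ℂ E]

/-- The span of the eigenspaces of `A` with eigenvalues in `S`. -/
def eigenspaceSpan (A : E →ₗ.[ℂ] E) (S : Set ℂ) : Submodule ℂ E :=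
  ⨆ z ∈ S, eigenspace A z

theorem eigenspace_le_eigenspaceSpan (A : E →ₗ.[ℂ] E) {S : Set ℂ} {z : ℂ} (hz : z ∈ S) :
    eigenspace A z ≤ eigenspaceSpan A S :=
  le_iSup₂_of_le z hz le_rfl

/-- `D` preserves each eigenspace of `D²`: if `D² x = z x`, then `D² (D x) = z D x`, and `D x` lies
in the required domains. -/
theorem exists_mem_eigenspaceSpan {D : E →ₗ.[ℂ] E} {S : Set ℂ} :
    ∀ x ∈ eigenspaceSpan (opSq D) S, ∃ y ∈ eigenspaceSpan (opSq D) S, (x, y) ∈ D.graph := by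
  have h : eigenspaceSpan (opSq D) S ≤ (D.graph ⊓ Submodule.prod ⊤
      (eigenspaceSpan (opSq D) S)).map (LinearMap.fst ℂ E E) := by
    refine iSup₂_le fun z hz x hx => ?_
    obtain ⟨d, h1, h2⟩ := mem_graph_opSq.1 (mem_eigenspace_iff.1 hx)
    refine ⟨(x, d), ⟨h1, Submodule.mem_top, eigenspace_le_eigenspaceSpan _ hz ?_⟩, rfl⟩
    rw [mem_eigenspace_iff]
    exact mem_graph_opSq.2 ⟨_, h2, D.graph.smul_mem z h1⟩
  intro x hx
  obtain ⟨⟨x', y⟩, ⟨h1, -, h2⟩, rfl⟩ := h hx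
  exact ⟨y, h2, h1⟩

theorem AnticommutesWith.map_mem_eigenspaceSpan {θ : E →L[ℂ] E} {D : E →ₗ.[ℂ] E}
    (hθ : AnticommutesWith θ D) {S : Set ℂ} :
    ∀ x ∈ eigenspaceSpan (IntersectingBranes.opSq D) S,
      (θ : E →ₗ[ℂ] E) x ∈ eigenspaceSpan (IntersectingBranes.opSq D) S := by
  have h : eigenspaceSpan (IntersectingBranes.opSq D) S ≤
      (eigenspaceSpan (IntersectingBranes.opSq D) S).comap (θ : E →ₗ[ℂ] E) := by
    refine iSup₂_le fun z hz x hx => eigenspace_le_eigenspaceSpan _ hz ?_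
    rw [mem_eigenspace_iff] at hx ⊢
    have := hθ.opSq hx
    rwa [map_smul] at this
  exact h

theorem IsSqResolvent.exists_relBounded {D B : E →ₗ.[ℂ] E} {R : E →L[ℂ] E}
    (hR : IsSqResolvent D R) (hB : IsRelBounded B (opSq D)) :
    ∃ S : E →L[ℂ] E, ∀ y, (R y, S y) ∈ B.graph := by
  obtain ⟨a, b, ha, hb, h⟩ := hB.exists_bound
  choose w h1 h2 using fun y => h _ _ (hR y)
  let S₀ : E →ₗ[ℂ] E :=
    { toFun := w
      map_add' := fun x y => by
        have := B.graph.add_mem (h1 x) (h1 y)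
        rw [Prod.mk_add_mk, ← map_add] at this
        exact graph_unique (h1 _) this
      map_smul' := fun c x => by
        have := B.graph.smul_mem c (h1 x)
        rw [Prod.smul_mk, ← map_smul] at this
        exact graph_unique (h1 _) this }
  refine ⟨S₀.mkContinuous (a * (1 + ‖R‖) + b * ‖R‖) fun y => ?_, h1⟩
  change ‖w y‖ ≤ _
  have e2 : ‖R y‖ ≤ ‖R‖ * ‖y‖ := R.le_opNorm y
  have e3 : ‖y - R y‖ ≤ (1 + ‖R‖) * ‖y‖ := by
    refine (norm_sub_le _ _).trans ?_
    linarith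
  calc ‖w y‖ ≤ a * ‖y - R y‖ + b * ‖R y‖ := h2 y
    _ ≤ a * ((1 + ‖R‖) * ‖y‖) + b * (‖R‖ * ‖y‖) := by gcongr
    _ = _ := by ring

/-- Expanding the square gives `((D + tD')² + 1) R = 1 + tB + t²C`. The hypotheses on `B` and `C`
place `R y` in the domain of every term. The domain of `(D + tD')²` need not be determined, since a
right inverse suffices. -/
theorem IsSqResolvent.perturb {D D' : E →ₗ.[ℂ] E} {R B C : E →L[ℂ] E}
    (hR : IsSqResolvent D R) (hB : ∀ y, (R y, B y) ∈ (antiComm D' D).graph)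
    (hC : ∀ y, (R y, C y) ∈ (opSq D').graph) {t : ℂ}
    (hu : IsUnit (1 + t • B + (t * t) • C)) :
    IsSqResolvent (D + t • D') (R * Ring.inverse (1 + t • B + (t * t) • C)) := by
  have key : ∀ y, (R y, (1 + t • B + (t * t) • C) y - R y) ∈ (opSq (D + t • D')).graph := by
    intro y
    obtain ⟨d, h1, h2⟩ := mem_graph_opSq.1 (hR y)
    obtain ⟨e, e', w, w', h3, h4, h5, h6, h7⟩ := mem_graph_antiComm.1 (hB y)
    obtain ⟨f, h8, h9⟩ := mem_graph_opSq.1 (hC y)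
    obtain rfl := graph_unique h1 h3
    obtain rfl := graph_unique h5 h8
    have g1 : (R y, d + t • e') ∈ (D + t • D').graph :=
      mem_graph_add.2 ⟨_, _, h1, mem_graph_smul.2 ⟨_, h5, rfl⟩, rfl⟩
    have g2 : (d, (y - R y) + t • w) ∈ (D + t • D').graph :=
      mem_graph_add.2 ⟨_, _, h2, mem_graph_smul.2 ⟨_, h4, rfl⟩, rfl⟩
    have g3 : (e', w' + t • C y) ∈ (D + t • D').graph :=
      mem_graph_add.2 ⟨_, _, h6, mem_graph_smul.2 ⟨_, h9, rfl⟩, rfl⟩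
    have g4 := (D + t • D').graph.add_mem g2 ((D + t • D').graph.smul_mem t g3)
    refine mem_graph_opSq.2 ⟨_, g1, ?_⟩
    have e : (1 + t • B + (t * t) • C) y - R y = y - R y + t • w + t • (w' + t • C y) := by
      simp only [add_apply, smul_apply, one_apply_eq_self, h7]
      module
    rw [e]
    exact g4
  intro y
  have h1 := key (Ring.inverse (1 + t • B + (t * t) • C) y)
  rwa [← mul_apply_eq_comp (1 + t • B + (t * t) • C), Ring.mul_inverse_cancel _ hu,
    one_apply_eq_self] at h1

end EigenspaceSpan

universe u

variable {E : Type u} [NormedAddCommGroup E] [InnerProductSpace ℂ E] [CompleteSpace E]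

/-- The chirality index of a symmetric operator `D` with compact resolvent `(D² + 1)⁻¹` counts the
zero modes of `D` with their chirality. -/
theorem IsSqResolvent.hasChiralityIndex {D : E →ₗ.[ℂ] E} {R : E →L[ℂ] E}
    (hR : IsSqResolvent D R) (hD : SymmetricOp D) (hcomp : IsCompactOperator R)
    {θ : E →L[ℂ] E} (hθ : AnticommutesWith θ D) (hθ2 : ∀ x, θ (θ x) = x) :
    HasChiralityIndex D θ (signedDim θ (eigenspace (opSq D) 0)) := by
  constructor
  · have h1 := hR.eventually_inResolventSet hD hcomp (z := 0) (by simp)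
    rw [eventually_nhdsWithin_iff, Metric.eventually_nhds_iff] at h1
    obtain ⟨ε, hε, h⟩ := h1
    -- The punctured disc of radius `ε` about `0` lies in the resolvent set, so this circle meets no
    -- eigenvalue.
    refine ⟨ClosedCurve.circle (ε / 2) (half_pos hε),
      ClosedCurve.circle_encircles_zero _, fun z hz => ?_⟩
    rw [ClosedCurve.mem_circle_image] at hz
    refine (h (y := z) ?_ ?_).not_isEigenvalue
    · rw [dist_zero_right, hz]
      exact half_lt_self hε
    · rintro rfl
      rw [norm_zero] at hz
      linarith
  · intro Γ hΓ
    obtain ⟨M, hM, hb⟩ := Γ.exists_norm_le_of_encircles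
    obtain ⟨c, hc0, hc, hcM⟩ := hR.exists_cutSpace_ge hD hcomp hM
    set W := eigenspaceSpan (opSq D) {z | Γ.Encircles z} with hW
    have hWle : W ≤ cutSpace R c :=
      iSup₂_le fun z hz => hR.eigenspace_le_cutSpace hD hM hc hcM (hb z hz)
    have := finiteDimensional_cutSpace (hR.isSelfAdjoint hD) hcomp hc0 hc
    have hfd : FiniteDimensional ℂ W := Submodule.finiteDimensional_of_le hWle
    have h1 := hasTrace_starProjection_comp θ W hθ.map_mem_eigenspaceSpan
    rw [trace_restrict_eq_signedDim hθ2, signedDim_eq_signedDim_ker hD hθ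
      exists_mem_eigenspaceSpan (eigenspace_le_eigenspaceSpan _ hΓ.1),
      ← starProjection_topologicalClosure] at h1
    exact h1

/-- A vector in one cut space killed by the other projection has quadratic forms for `R` and `S` at
least `ε ‖x‖²` apart, yet they differ by at most `‖S - R‖ ‖x‖²`. Only `R` needs a quantitative gap.
-/
theorem signedDim_cutSpace_eq_of_norm_sub_lt {R S θ : E →L[ℂ] E} (hR : IsSelfAdjoint R)
    (hS : IsSelfAdjoint S) (hRc : IsCompactOperator R) (hSc : IsCompactOperator S)
    (hRθ : Commute R θ) (hSθ : Commute S θ) {c ε : ℝ} (hc0 : 0 < c) (hcR : c ∉ spectrum ℝ R)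
    (hcS : c ∉ spectrum ℝ S) (hε : ∀ r ∈ spectrum ℝ R, ε ≤ |r - c|) (hRS : ‖S - R‖ < ε) :
    signedDim θ (cutSpace S c) = signedDim θ (cutSpace R c) := by
  have hε0 : 0 < ε := (norm_nonneg _).trans_lt hRS
  have := finiteDimensional_cutSpace hR hRc hc0 hcR
  have := finiteDimensional_cutSpace hS hSc hc0 hcS
  have hε1 : ∀ r ∈ spectrum ℝ R, c ≤ r → c + ε ≤ r := fun r hr h => by
    have := hε r hr
    rw [abs_of_nonneg (sub_nonneg.2 h)] at this
    linarith
  have hε2 : ∀ r ∈ spectrum ℝ R, r < c → r ≤ c - ε := fun r hr h => by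
    have := hε r hr
    rw [abs_of_neg (sub_neg.2 h)] at this
    linarith
  have hdiff : ∀ x, |(⟪x, S x⟫_ℂ).re - (⟪x, R x⟫_ℂ).re| ≤ ‖S - R‖ * ‖x‖ ^ 2 := by
    intro x
    rw [← Complex.sub_re, ← inner_sub_right]
    calc |(⟪x, S x - R x⟫_ℂ).re| ≤ ‖⟪x, S x - R x⟫_ℂ‖ := Complex.abs_re_le_norm _
      _ ≤ ‖x‖ * ‖(S - R) x‖ := norm_inner_le_norm _ _
      _ ≤ ‖x‖ * (‖S - R‖ * ‖x‖) := by gcongr; exact (S - R).le_opNorm x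
      _ = _ := by ring
  have hzero : ∀ x : E, ε * ‖x‖ ^ 2 ≤ ‖S - R‖ * ‖x‖ ^ 2 → x = 0 := by
    intro x hx
    have h3 : ‖x‖ ^ 2 = 0 := le_antisymm (by nlinarith [sq_nonneg ‖x‖]) (sq_nonneg _)
    simpa using h3
  refine signedDim_eq_of_injOn (Commute.cutProj hRθ c) (Commute.cutProj hSθ c)
    (fun x _ => cutProj_apply_mem hcR x) (fun x hx hx0 => hzero x ?_)
    (fun x _ => cutProj_apply_mem hcS x) (fun x hx hx0 => hzero x ?_)
  · have h1 := le_re_inner_of_mem_cutSpace hS (ε := 0) hcS (fun s _ h => by simpa using h) hx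
    have h2 := re_inner_le_of_cutProj_eq_zero hR hcR hε2 hx0
    have h3 := (abs_le.1 (hdiff x)).2
    linarith
  · have h1 := le_re_inner_of_mem_cutSpace hR hcR hε1 hx
    have h2 := re_inner_le_of_cutProj_eq_zero hS (ε := 0) hcS
      (fun s _ h => by rw [sub_zero]; exact h.le) hx0
    have h3 := (abs_le.1 (hdiff x)).1
    linarith

/-- Stability of the chirality index under relatively bounded perturbations. -/
theorem exists_hasChiralityIndex_perturb {D D' : E →ₗ.[ℂ] E} {θ : E →L[ℂ] E}
    (hD : SymmetricOp D) (hD' : SymmetricOp D') (hθ : AnticommutesWith θ D)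
    (hθ' : AnticommutesWith θ D') (hθ2 : ∀ x, θ (θ x) = x)
    (hdisc : HasDiscreteSpectrum (opSq D)) (hsq : IsRelBounded (opSq D') (opSq D))
    (hanti : IsRelBounded (antiComm D' D) (opSq D)) :
    ∃ n : ℤ, HasChiralityIndex D θ n ∧ ∃ U ∈ nhds (0 : ℝ), ∀ t ∈ U,
      HasDiscreteSpectrum (opSq (D + (t : ℂ) • D')) ∧
      HasChiralityIndex (D + (t : ℂ) • D') θ n := by
  obtain ⟨R, hR⟩ := hdisc.exists_isSqResolvent hD
  have hcomp := hR.isCompactOperator hD hdisc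
  have hRsa := hR.isSelfAdjoint hD
  obtain ⟨B, hB⟩ := hR.exists_relBounded hanti
  obtain ⟨C, hC⟩ := hR.exists_relBounded hsq
  refine ⟨_, hR.hasChiralityIndex hD hcomp hθ hθ2, ?_⟩
  obtain ⟨c, hcR, hc0, hc1⟩ : ∃ c : ℝ, c ∉ spectrum ℝ R ∧ 0 < c ∧ c < 1 := by
    obtain ⟨c, hc0, hc, hcM⟩ := hR.exists_cutSpace_ge hD hcomp (le_refl 0)
    exact ⟨c, hc, hc0, by simpa using hcM⟩
  obtain ⟨ε, hε0, hε⟩ : ∃ ε > 0, ∀ r ∈ spectrum ℝ R, ε ≤ |r - c| := by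
    have hop : IsOpen (spectrum ℝ R)ᶜ := (spectrum.isClosed R).isOpen_compl
    obtain ⟨ε, hε, hsub⟩ := Metric.isOpen_iff.1 hop c hcR
    refine ⟨ε, hε, fun r hr => ?_⟩
    by_contra! hlt
    exact hsub (by rwa [Metric.mem_ball, Real.dist_eq]) hr
  set K : ℝ → E →L[ℂ] E := fun t => 1 + (t : ℂ) • B + ((t : ℂ) * t) • C with hK
  have hKc : Continuous K := by
    have := Complex.continuous_ofReal
    fun_prop
  have hK0 : K 0 = 1 := by simp [hK]
  have hunit : ∀ᶠ t in 𝓝 (0 : ℝ), IsUnit (K t) := by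
    refine hKc.continuousAt.eventually (Units.isOpen.eventually_mem ?_)
    rw [hK0]
    exact isUnit_one
  have hS : Filter.Tendsto (fun t => R * Ring.inverse (K t)) (𝓝 0) (𝓝 R) := by
    have h1 : ContinuousAt Ring.inverse (K 0) := by
      rw [hK0]
      exact NormedRing.inverse_continuousAt (1 : (E →L[ℂ] E)ˣ)
    have h2 := (h1.comp hKc.continuousAt).tendsto.const_mul R
    simpa [hK0] using h2
  have hnorm : ∀ᶠ t in 𝓝 (0 : ℝ), ‖R * Ring.inverse (K t) - R‖ < ε := by
    have := hS.eventually (Metric.ball_mem_nhds R hε0)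
    simpa only [Metric.mem_ball, dist_eq_norm] using this
  have hspec : ∀ᶠ t in 𝓝 (0 : ℝ), c ∉ spectrum ℝ (R * Ring.inverse (K t)) := by
    have h1 : IsUnit (algebraMap ℝ (E →L[ℂ] E) c - R) := by
      -- Invertibility of `c - R` is an open condition, so `c` also avoids the spectrum of the
      -- nearby resolvents.
      rwa [spectrum.mem_iff, not_not] at hcR
    have h2 := (hS.const_sub (algebraMap ℝ (E →L[ℂ] E) c)).eventually
      (Units.isOpen.eventually_mem h1)
    exact h2.mono fun t ht => by rwa [spectrum.mem_iff, not_not]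
  refine ⟨_, hunit.and (hnorm.and hspec), ?_⟩
  rintro t ⟨ht1, ht2, ht3⟩
  have hDt : SymmetricOp (D + (t : ℂ) • D') := hD.add (hD'.real_smul t)
  have hθt : AnticommutesWith θ (D + (t : ℂ) • D') := hθ.add (hθ'.smul t)
  have hSt : IsSqResolvent (D + (t : ℂ) • D') (R * Ring.inverse (K t)) := hR.perturb hB hC ht1
  have hSc : IsCompactOperator (R * Ring.inverse (K t)) := hcomp.comp_clm _
  refine ⟨hSt.hasDiscreteSpectrum hDt hSc, ?_⟩
  have h1 := signedDim_cutSpace_eq_of_norm_sub_lt hRsa (hSt.isSelfAdjoint hDt) hcomp hSc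
    (hR.commute_of_graph hD hθ).symm (hSt.commute_of_graph hDt hθt).symm hc0 hcR ht3 hε ht2
  rw [hSt.signedDim_cutSpace hDt hSc hθt hc0 hc1 ht3,
    hR.signedDim_cutSpace hD hcomp hθ hc0 hc1 hcR] at h1
  rw [← h1]
  exact hSt.hasChiralityIndex hDt hSc hθt hθ2

end ChiralityIndex

/-! ### The Clifford algebra -/

section Clifford

/-- Each factor passed contributes a sign, except `δ i` itself; adding `1` to the exponent has the
same parity as omitting that factor. -/
theorem IsEuclideanClifford.mul_prod {n N : ℕ} {δ : Fin n → Matrix (Fin N) (Fin N) ℂ}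
    (hδ : IsEuclideanClifford δ) (i : Fin n) {l : List (Fin n)} (hl : l.Nodup) :
    δ i * (l.map δ).prod =
      (-1 : ℂ) ^ (l.length + if i ∈ l then 1 else 0) • ((l.map δ).prod * δ i) := by
  induction l with
  | nil => simp
  | cons j l ih =>
    rw [List.nodup_cons] at hl
    have ih := ih hl.2
    simp only [List.map_cons, List.prod_cons, List.length_cons, List.mem_cons]
    by_cases hij : i = j
    · subst hij
      simp only [hl.1, if_false, add_zero] at ih
      simp only [true_or, if_true]
      nth_rw 1 [ih]
      rw [mul_smul_comm, ← mul_assoc]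
      congr 1
      rw [pow_add, pow_add]
      norm_num
    · have h := hδ.anticomm i j
      rw [if_neg hij] at h
      simp only [hij, false_or]
      rw [← mul_assoc, eq_neg_of_add_eq_zero_left h, neg_mul, mul_assoc, ih, mul_smul_comm,
        ← mul_assoc, ← neg_smul]
      congr 1
      ring

theorem IsEuclideanClifford.prod_mul_prod {n N : ℕ} {δ : Fin n → Matrix (Fin N) (Fin N) ℂ}
    (hδ : IsEuclideanClifford δ) {l : List (Fin n)} (hl : l.Nodup) :
    (l.map δ).prod * (l.map δ).prod = (-1 : ℂ) ^ (l.length.choose 2) • 1 := by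
  induction l with
  | nil => simp
  | cons j l ih =>
    rw [List.nodup_cons] at hl
    have ih := ih hl.2
    have hc := hδ.mul_prod j hl.2
    simp only [hl.1, if_false, add_zero] at hc
    have hsq : δ j * δ j = 1 := by
      have h := hδ.anticomm j j
      rw [if_pos rfl, ← two_mul] at h
      have h2 : (2 : ℂ) • (δ j * δ j) = (2 : ℂ) • 1 := by
        rw [two_smul, two_smul, ← two_mul, h]
        norm_num
      exact smul_right_injective _ (two_ne_zero (α := ℂ)) h2
    simp only [List.map_cons, List.prod_cons, List.length_cons]
    calc δ j * (l.map δ).prod * (δ j * (l.map δ).prod)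
        = (δ j * (l.map δ).prod * δ j) * (l.map δ).prod := by simp only [mul_assoc]
      _ = ((-1 : ℂ) ^ l.length • ((l.map δ).prod * δ j)) * δ j * (l.map δ).prod := by rw [hc]
      _ = (-1 : ℂ) ^ l.length • ((l.map δ).prod * (δ j * δ j) * (l.map δ).prod) := by
          simp only [smul_mul_assoc, mul_assoc]
      _ = _ := by
          rw [hsq, mul_one, ih, smul_smul, ← pow_add, Nat.choose_succ_succ' l.length 1,
            Nat.choose_one_right]

theorem IsEuclideanClifford.anticomm_prod {n N : ℕ} {δ : Fin n → Matrix (Fin N) (Fin N) ℂ}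
    (hδ : IsEuclideanClifford δ) (hn : Even n) (i : Fin n) :
    δ i * (List.ofFn δ).prod = -((List.ofFn δ).prod * δ i) := by
  have h := hδ.mul_prod i (List.nodup_finRange n)
  rw [List.ofFn_eq_map, h, List.length_finRange, if_pos (List.mem_finRange i), pow_succ,
    hn.neg_one_pow, one_mul, neg_one_smul]

theorem IsEuclideanClifford.chirality_mul_self {n N : ℕ} {δ : Fin n → Matrix (Fin N) (Fin N) ℂ}
    (hδ : IsEuclideanClifford δ) (hn : Even n) :
    ((Complex.I⁻¹) ^ (n / 2) • (List.ofFn δ).prod) * ((Complex.I⁻¹) ^ (n / 2) • (List.ofFn δ).prod)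
      = 1 := by
  rw [smul_mul_smul_comm, List.ofFn_eq_map, hδ.prod_mul_prod (List.nodup_finRange n),
    List.length_finRange, smul_smul, ← mul_pow]
  obtain ⟨m, rfl⟩ := hn
  have h1 : Complex.I⁻¹ * Complex.I⁻¹ = -1 := by
    rw [← mul_inv, Complex.I_mul_I]
    norm_num
  have h2 : (m + m) / 2 = m := by omega
  -- Reordering the square contributes the exponent `(2m).choose 2`, and the prefactor `i^{-n/2}`
  -- squared contributes `m`; the total is even.
  have h3 : (m + m).choose 2 + m = 2 * (m * m) := by
    rw [Nat.choose_two_right]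
    rcases m with _ | m
    · rfl
    · have : (m + 1 + (m + 1)) * (m + 1 + (m + 1) - 1) = 2 * ((m + 1) * (2 * m + 1)) := by
        have : m + 1 + (m + 1) - 1 = 2 * m + 1 := by omega
        rw [this]
        ring
      rw [this, Nat.mul_div_cancel_left _ two_pos]
      ring
  rw [h1, h2, ← pow_add, add_comm, h3, pow_mul]
  simp

end Clifford

/-! ### Self-adjoint operators -/

section SelfAdjoint

variable {H : Type*} [NormedAddCommGroup H] [InnerProductSpace ℂ H]

theorem mem_graph_sub {A B : H →ₗ.[ℂ] H} {x z : H} :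
    (x, z) ∈ (A - B).graph ↔ ∃ a b, (x, a) ∈ A.graph ∧ (x, b) ∈ B.graph ∧ z = a - b := by
  constructor
  · intro h
    obtain ⟨⟨u, hu⟩, rfl, rfl⟩ := (LinearPMap.mem_graph_iff _).1 h
    exact ⟨A ⟨u, hu.1⟩, B ⟨u, hu.2⟩, A.mem_graph ⟨u, hu.1⟩, B.mem_graph ⟨u, hu.2⟩, rfl⟩
  · rintro ⟨a, b, ha, hb, rfl⟩
    obtain ⟨⟨u, hu⟩, rfl, rfl⟩ := (LinearPMap.mem_graph_iff _).1 ha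
    obtain ⟨⟨v, hv⟩, hv', rfl⟩ := (LinearPMap.mem_graph_iff _).1 hb
    obtain rfl : v = u := hv'
    exact (LinearPMap.mem_graph_iff _).2 ⟨⟨v, hu, hv⟩, rfl, rfl⟩

theorem SymmetricOp.sub {A B : H →ₗ.[ℂ] H} (hA : SymmetricOp A) (hB : SymmetricOp B) :
    SymmetricOp (A - B) := by
  intro x x' y y' hx hy
  obtain ⟨a, b, h1, h2, rfl⟩ := mem_graph_sub.1 hx
  obtain ⟨c, d, h3, h4, rfl⟩ := mem_graph_sub.1 hy
  rw [inner_sub_left, inner_sub_right, hA _ _ _ _ h1 h3, hB _ _ _ _ h2 h4]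

variable [CompleteSpace H]

theorem symmetricOp_of_isSelfAdjoint {X : H →ₗ.[ℂ] H} (hX : IsSelfAdjoint X) : SymmetricOp X := by
  intro x x' y y' hx hy
  obtain ⟨u, rfl, rfl⟩ := (LinearPMap.mem_graph_iff _).1 hx
  obtain ⟨v, rfl, rfl⟩ := (LinearPMap.mem_graph_iff _).1 hy
  have h := LinearPMap.adjoint_isFormalAdjoint hX.dense_domain
  rw [LinearPMap.isSelfAdjoint_def.1 hX] at h
  exact h u v

/-- This is the maximality that separates self-adjoint from merely symmetric; right multiplication
depends on it. -/
theorem mem_graph_of_isSelfAdjoint {X : H →ₗ.[ℂ] H} (hX : IsSelfAdjoint X) {w w' : H}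
    (h : ∀ v : X.domain, ⟪w', v⟫_ℂ = ⟪w, X v⟫_ℂ) : (w, w') ∈ X.graph := by
  rw [← LinearPMap.isSelfAdjoint_def.1 hX]
  have hw := X.mem_adjoint_domain_of_exists w ⟨w', h⟩
  exact (LinearPMap.mem_graph_iff _).2
    ⟨⟨w, hw⟩, rfl, LinearPMap.adjoint_apply_eq hX.dense_domain ⟨w, hw⟩ h⟩

end SelfAdjoint

/-! ### Parseval sums -/

section Parseval

variable {H : Type*} [NormedAddCommGroup H] [InnerProductSpace ℂ H]

theorem hasSum_norm_sq_inner {ι : Type*} (f : HilbertBasis ι ℂ H) (x : H) :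
    HasSum (fun j => ‖⟪f j, x⟫_ℂ‖ ^ 2) (‖x‖ ^ 2) := by
  have h := lp.hasSum_norm (p := 2) (by norm_num) (f.repr x)
  simpa [f.repr_apply_apply] using h

theorem summable_norm_sq_inner {ι κ : Type*} (f : HilbertBasis ι ℂ H) {y : κ → H}
    (hy : Summable fun i => ‖y i‖ ^ 2) :
    Summable (fun p : κ × ι => ‖⟪f p.2, y p.1⟫_ℂ‖ ^ 2) := by
  rw [summable_prod_of_nonneg fun _ => by positivity]
  refine ⟨fun i => (hasSum_norm_sq_inner f (y i)).summable, ?_⟩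
  simp only [fun i => (hasSum_norm_sq_inner f (y i)).tsum_eq]
  exact hy

/-- Parseval in each term, then an exchange of sums justified by the bound `a b ≤ a² + b²`. -/
theorem tsum_inner_eq_tsum_tsum {ι κ : Type*} (f : HilbertBasis ι ℂ H) {y z : κ → H}
    (hy : Summable fun i => ‖y i‖ ^ 2) (hz : Summable fun i => ‖z i‖ ^ 2) :
    ∑' i, ⟪y i, z i⟫_ℂ = ∑' j, ∑' i, ⟪y i, f j⟫_ℂ * ⟪f j, z i⟫_ℂ := by
  have hsum : Summable (Function.uncurry fun i j => ⟪y i, f j⟫_ℂ * ⟪f j, z i⟫_ℂ) := by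
    refine Summable.of_norm_bounded
      ((summable_norm_sq_inner f hy).add (summable_norm_sq_inner f hz)) fun p => ?_
    obtain ⟨i, j⟩ := p
    change ‖⟪y i, f j⟫_ℂ * ⟪f j, z i⟫_ℂ‖ ≤ ‖⟪f j, y i⟫_ℂ‖ ^ 2 + ‖⟪f j, z i⟫_ℂ‖ ^ 2
    rw [norm_mul, norm_inner_symm (y i)]
    generalize ‖⟪f j, y i⟫_ℂ‖ = a
    generalize ‖⟪f j, z i⟫_ℂ‖ = b
    nlinarith [sq_nonneg (a - b), sq_nonneg a, sq_nonneg b]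
  rw [hsum.tsum_comm]
  exact tsum_congr fun i => (f.tsum_inner_mul_inner (y i) (z i)).symm

end Parseval

/-! ### Multiplication operators on Hilbert-Schmidt operators -/

section Multiplication

universe u v

variable {K : Type u} {H : Type v}
  [NormedAddCommGroup K] [InnerProductSpace ℂ K] [CompleteSpace K]
  [NormedAddCommGroup H] [InnerProductSpace ℂ H]

theorem HS.summable_norm_sq (T : HS K H) :
    Summable (fun i => ‖HS.toCLM T (refBasis K i)‖ ^ 2) := by
  have h := lp.hasSum_norm (p := 2) (by norm_num) (HS.coords T)
  have h' : Summable fun i => ‖HS.coords T i‖ ^ 2 := by simpa using h.summable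
  exact h'

variable [CompleteSpace H]

/-- The Hilbert-Schmidt inner product of two operators is that of their adjoints. -/
theorem HS.inner_eq_tsum_adjoint {ι : Type*} (f : HilbertBasis ι ℂ H) (S T : HS K H) :
    ⟪S, T⟫_ℂ = ∑' j, ⟪ContinuousLinearMap.adjoint (HS.toCLM T) (f j),
      ContinuousLinearMap.adjoint (HS.toCLM S) (f j)⟫_ℂ := by
  rw [HS.inner_eq_tsum, tsum_inner_eq_tsum_tsum f S.summable_norm_sq T.summable_norm_sq]
  refine tsum_congr fun j => ?_
  rw [← (refBasis K).tsum_inner_mul_inner]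
  refine tsum_congr fun i => ?_
  rw [ContinuousLinearMap.adjoint_inner_left, ContinuousLinearMap.adjoint_inner_right, mul_comm]

theorem mem_graph_leftMul {X : H →ₗ.[ℂ] H} {Ψ Φ : HS K H} :
    (Ψ, Φ) ∈ (leftMul X).graph ↔ ∀ v, (HS.toCLM Ψ v, HS.toCLM Φ v) ∈ X.graph := by
  rw [leftMul, Submodule.toLinearPMap_graph_eq]
  · rfl
  · rintro ⟨Ψ, Φ⟩ h (rfl : Ψ = 0)
    refine HS.toCLM_injective (ContinuousLinearMap.ext fun v => ?_)
    rw [map_zero]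
    exact X.graph_fst_eq_zero_snd (h v) (by simp)

/-- `Submodule.toLinearPMap` has the prescribed graph once the relation is single-valued; here this
follows from density of `D(X)` and continuity. -/
theorem mem_graph_rightMul {X : K →ₗ.[ℂ] K} (hX : IsSelfAdjoint X) {Ψ Φ : HS K H} :
    (Ψ, Φ) ∈ (rightMul X).graph ↔ ∀ v : X.domain, HS.toCLM Φ v = HS.toCLM Ψ (X v) := by
  rw [rightMul, Submodule.toLinearPMap_graph_eq]
  · rfl
  · rintro ⟨Ψ, Φ⟩ h (rfl : Ψ = 0)
    refine HS.toCLM_injective (DFunLike.coe_injective ?_)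
    refine Continuous.ext_on hX.dense_domain (HS.toCLM Φ).continuous
      (HS.toCLM (0 : HS K H)).continuous fun v hv => ?_
    have := h ⟨v, hv⟩
    simpa using this

theorem symmetricOp_leftMul {X : H →ₗ.[ℂ] H} (hX : IsSelfAdjoint X) :
    SymmetricOp (leftMul X : HS K H →ₗ.[ℂ] HS K H) := by
  intro Ψ Φ Ψ' Φ' h h'
  rw [mem_graph_leftMul] at h h'
  rw [HS.inner_eq_tsum, HS.inner_eq_tsum]
  exact tsum_congr fun i => symmetricOp_of_isSelfAdjoint hX _ _ _ _ (h _) (h' _)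

/-- Adjoints turn right multiplication into left multiplication: `Ψ X ⊆ Φ` gives `X Ψ* = Φ*`, by
self-adjointness of `X`. The Hilbert-Schmidt inner product is then computed from the adjoints. -/
theorem symmetricOp_rightMul {X : K →ₗ.[ℂ] K} (hX : IsSelfAdjoint X) :
    SymmetricOp (rightMul X : HS K H →ₗ.[ℂ] HS K H) := by
  have key : ∀ Ψ Φ : HS K H, (Ψ, Φ) ∈ (rightMul X).graph → ∀ w,
      (ContinuousLinearMap.adjoint (HS.toCLM Ψ) w, ContinuousLinearMap.adjoint (HS.toCLM Φ) w) ∈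
        X.graph := by
    intro Ψ Φ h w
    rw [mem_graph_rightMul hX] at h
    refine mem_graph_of_isSelfAdjoint hX fun v => ?_
    rw [ContinuousLinearMap.adjoint_inner_left, ContinuousLinearMap.adjoint_inner_left, h]
  intro Ψ Φ Ψ' Φ' h h'
  rw [HS.inner_eq_tsum_adjoint (refBasis H), HS.inner_eq_tsum_adjoint (refBasis H)]
  exact tsum_congr fun j =>
    (symmetricOp_of_isSelfAdjoint hX _ _ _ _ (key _ _ h' _) (key _ _ h _)).symm

end Multiplication

/-! ### The Dirac operator -/

section DiracOperator

universe u v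

variable {K : Type u} {H : Type v}
  [NormedAddCommGroup K] [InnerProductSpace ℂ K] [CompleteSpace K]
  [NormedAddCommGroup H] [InnerProductSpace ℂ H] [CompleteSpace H] {N : ℕ}

theorem spinAct_spinAct (M M' : Matrix (Fin N) (Fin N) ℂ) (Ψ : SpinorSpace K H N) :
    spinAct M (spinAct M' Ψ) = spinAct (M * M') Ψ := by
  ext1 a
  simp only [spinAct_apply, Finset.smul_sum, smul_smul, Matrix.mul_apply, Finset.sum_smul]
  exact Finset.sum_comm

theorem spinAct_one (Ψ : SpinorSpace K H N) : spinAct (1 : Matrix (Fin N) (Fin N) ℂ) Ψ = Ψ := by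
  ext1 a
  simp [spinAct_apply, Matrix.one_apply]

theorem spinAct_neg (M : Matrix (Fin N) (Fin N) ℂ) (Ψ : SpinorSpace K H N) :
    spinAct (-M) Ψ = -spinAct M Ψ := by
  ext1 a
  simp [spinAct_apply]

theorem inner_spinAct_left {M : Matrix (Fin N) (Fin N) ℂ} (hM : M.IsHermitian)
    (Ψ Φ : SpinorSpace K H N) : ⟪spinAct M Ψ, Φ⟫_ℂ = ⟪Ψ, spinAct M Φ⟫_ℂ := by
  simp only [PiLp.inner_apply, spinAct_apply, sum_inner, inner_sum, inner_smul_left,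
    inner_smul_right]
  rw [Finset.sum_comm]
  refine Finset.sum_congr rfl fun a _ => Finset.sum_congr rfl fun b _ => ?_
  congr 1
  exact hM.apply a b

theorem mem_graph_spinLift {A : HS K H →ₗ.[ℂ] HS K H} {Ψ Φ : SpinorSpace K H N} :
    (Ψ, Φ) ∈ (spinLift A).graph ↔ ∀ a, (Ψ a, Φ a) ∈ A.graph := by
  constructor
  · intro h a
    obtain ⟨u, rfl, rfl⟩ := (LinearPMap.mem_graph_iff _).1 h
    exact A.mem_graph ⟨u.1 a, u.2 a⟩
  · intro h
    refine (LinearPMap.mem_graph_iff _).2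
      ⟨⟨Ψ, fun a => LinearPMap.mem_domain_of_mem_graph (h a)⟩, rfl, ?_⟩
    ext1 a
    exact graph_unique (A.mem_graph ⟨Ψ a, LinearPMap.mem_domain_of_mem_graph (h a)⟩) (h a)

theorem mem_graph_spinAct_compPMap {M : Matrix (Fin N) (Fin N) ℂ} {A : HS K H →ₗ.[ℂ] HS K H}
    {Ψ Φ : SpinorSpace K H N} :
    (Ψ, Φ) ∈ ((spinAct M).toLinearMap.compPMap (spinLift A)).graph ↔
      ∃ Ξ, (Ψ, Ξ) ∈ (spinLift A).graph ∧ Φ = spinAct M Ξ := by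
  constructor
  · intro h
    obtain ⟨u, rfl, rfl⟩ := (LinearPMap.mem_graph_iff _).1 h
    exact ⟨spinLift A u, (spinLift A).mem_graph u, rfl⟩
  · rintro ⟨Ξ, h, rfl⟩
    obtain ⟨u, rfl, rfl⟩ := (LinearPMap.mem_graph_iff _).1 h
    exact (LinearPMap.mem_graph_iff _).2 ⟨u, rfl, rfl⟩

theorem symmetricOp_spinAct_compPMap {M : Matrix (Fin N) (Fin N) ℂ} (hM : M.IsHermitian)
    {A : HS K H →ₗ.[ℂ] HS K H} (hA : SymmetricOp A) :
    SymmetricOp ((spinAct M).toLinearMap.compPMap (spinLift A)) := by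
  intro Ψ Φ Ψ' Φ' h h'
  obtain ⟨Ξ, h1, rfl⟩ := mem_graph_spinAct_compPMap.1 h
  obtain ⟨Ξ', h1', rfl⟩ := mem_graph_spinAct_compPMap.1 h'
  rw [mem_graph_spinLift] at h1 h1'
  -- Different components must be paired, since the matrix `M` mixes the spinor index.
  have hl : ∀ a b, ⟪Ξ a, Ψ' b⟫_ℂ = ⟪Ψ a, Ξ' b⟫_ℂ := fun a b => hA _ _ _ _ (h1 a) (h1' b)
  rw [inner_spinAct_left hM]
  simp only [PiLp.inner_apply, spinAct_apply, inner_sum, inner_smul_right, hl]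

theorem anticommutesWith_spinAct_compPMap {M T : Matrix (Fin N) (Fin N) ℂ}
    (hM : M * T = -(T * M)) (A : HS K H →ₗ.[ℂ] HS K H) :
    AnticommutesWith (spinAct T) ((spinAct M).toLinearMap.compPMap (spinLift A)) := by
  intro Ψ Φ h
  obtain ⟨Ξ, h1, rfl⟩ := mem_graph_spinAct_compPMap.1 h
  refine mem_graph_spinAct_compPMap.2 ⟨spinAct T Ξ, ?_, ?_⟩
  · rw [mem_graph_spinLift] at h1 ⊢
    intro a
    rw [spinAct_apply, spinAct_apply]
    have := A.graph.sum_mem (t := Finset.univ) fun b _ => A.graph.smul_mem (T a b) (h1 b)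
    simpa [Prod.fst_sum, Prod.snd_sum, prod_mk_sum] using this
  · rw [spinAct_spinAct, spinAct_spinAct, hM, spinAct_neg]

theorem symmetricOp_dirac {n : ℕ} {δ : Fin n → Matrix (Fin N) (Fin N) ℂ}
    (hδ : IsEuclideanClifford δ) {XL : Fin n → H →ₗ.[ℂ] H} {XR : Fin n → K →ₗ.[ℂ] K}
    (hXL : ∀ i, IsSelfAdjoint (XL i)) (hXR : ∀ i, IsSelfAdjoint (XR i)) :
    SymmetricOp (dirac δ XL XR) := by
  refine Finset.sum_induction _ SymmetricOp (fun _ _ => SymmetricOp.add) ?_ fun i _ =>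
    symmetricOp_spinAct_compPMap (hδ.hermitian i)
      ((symmetricOp_leftMul (hXL i)).sub (symmetricOp_rightMul (hXR i)))
  intro x x' y y' hx hy
  obtain ⟨u, -, rfl⟩ := (LinearPMap.mem_graph_iff _).1 hx
  obtain ⟨v, -, rfl⟩ := (LinearPMap.mem_graph_iff _).1 hy
  exact (inner_zero_left _).trans (inner_zero_right _).symm

theorem anticommutesWith_chirality_dirac {n : ℕ} {δ : Fin n → Matrix (Fin N) (Fin N) ℂ}
    (hδ : IsEuclideanClifford δ) (hn : Even n) (XL : Fin n → H →ₗ.[ℂ] H)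
    (XR : Fin n → K →ₗ.[ℂ] K) : AnticommutesWith (chirality δ) (dirac δ XL XR) := by
  refine Finset.sum_induction _
    (fun A : SpinorSpace K H N →ₗ.[ℂ] SpinorSpace K H N => AnticommutesWith (chirality δ) A)
    (fun _ _ => AnticommutesWith.add) ?_ fun i _ => ?_
  · intro x y hx
    obtain ⟨u, rfl, rfl⟩ := (LinearPMap.mem_graph_iff _).1 hx
    refine (LinearPMap.mem_graph_iff _).2 ⟨⟨_, Submodule.mem_top⟩, rfl, ?_⟩
    change (0 : SpinorSpace K H N) = -chirality δ 0
    rw [map_zero, neg_zero]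
  · refine anticommutesWith_spinAct_compPMap ?_ _
    rw [mul_smul_comm, hδ.anticomm_prod hn, smul_mul_assoc, smul_neg]

theorem chirality_chirality {n : ℕ} {δ : Fin n → Matrix (Fin N) (Fin N) ℂ}
    (hδ : IsEuclideanClifford δ) (hn : Even n) (Ψ : SpinorSpace K H N) :
    chirality δ (chirality δ Ψ) = Ψ := by
  rw [chirality, spinAct_spinAct, hδ.chirality_mul_self hn, spinAct_one]

end DiracOperator

end IntersectingBranes

end

theorem mainTheorem1
    {HL HR : Type*}
    [NormedAddCommGroup HL] [InnerProductSpace ℂ HL] [CompleteSpace HL]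
    [NormedAddCommGroup HR] [InnerProductSpace ℂ HR] [CompleteSpace HR]
    (d : ℕ) (hd : Even d) (hd10 : d ≤ 10)
    (δ : Fin (10 - d) → Matrix (Fin (2 ^ (5 - d / 2))) (Fin (2 ^ (5 - d / 2))) ℂ)
    (hδ : IntersectingBranes.IsEuclideanClifford δ)
    (XL XL' : Fin (10 - d) → HL →ₗ.[ℂ] HL) (XR XR' : Fin (10 - d) → HR →ₗ.[ℂ] HR)
    (hXL : ∀ i, IsSelfAdjoint (XL i)) (hXR : ∀ i, IsSelfAdjoint (XR i))
    (hXL' : ∀ i, IsSelfAdjoint (XL' i)) (hXR' : ∀ i, IsSelfAdjoint (XR' i))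
    (Δ Δ' : IntersectingBranes.SpinorSpace HR HL (2 ^ (5 - d / 2)) →ₗ.[ℂ]
      IntersectingBranes.SpinorSpace HR HL (2 ^ (5 - d / 2)))
    (hΔ : Δ = IntersectingBranes.dirac δ XL XR)
    (hΔ' : Δ' = IntersectingBranes.dirac δ XL' XR')
    (hdisc : IntersectingBranes.HasDiscreteSpectrum (IntersectingBranes.opSq Δ))
    (hsq : IntersectingBranes.IsRelBounded (IntersectingBranes.opSq Δ')
      (IntersectingBranes.opSq Δ))
    (hanti : IntersectingBranes.IsRelBounded (IntersectingBranes.antiComm Δ' Δ)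
      (IntersectingBranes.opSq Δ)) :
    ∃ n : ℤ,
      IntersectingBranes.HasChiralityIndex Δ (IntersectingBranes.chirality δ) n ∧
      ∃ U ∈ nhds (0 : ℝ), ∀ t ∈ U,
        IntersectingBranes.HasDiscreteSpectrum
          (IntersectingBranes.opSq (Δ + (t : ℂ) • Δ')) ∧
        IntersectingBranes.HasChiralityIndex (Δ + (t : ℂ) • Δ')
          (IntersectingBranes.chirality δ) n := by
  have hn : Even (10 - d) := by
    obtain ⟨k, rfl⟩ := hd
    exact ⟨5 - k, by omega⟩
  subst hΔ hΔ'
  exact IntersectingBranes.exists_hasChiralityIndex_perturb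
    (IntersectingBranes.symmetricOp_dirac hδ hXL hXR)
    (IntersectingBranes.symmetricOp_dirac hδ hXL' hXR')
    (IntersectingBranes.anticommutesWith_chirality_dirac hδ hn XL XR)
    (IntersectingBranes.anticommutesWith_chirality_dirac hδ hn XL' XR')
    (IntersectingBranes.chirality_chirality hδ hn) hdisc hsq hanti
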